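/- Let $X$ be a closed connected oriented smooth $4$-manifold, $B$ a closed connected oriented surface, and $f\colon X\to B$ a Lefschetz fibration: a smooth map such that around each critical point and its image there are orientation-preserving charts in which $f(z_1,z_2)=z_1^2+z_2^2$ (several critical points may lie in the same fiber). Suppose that the smooth fibers are connected surfaces of genus $h$. Let $k$ be the total number of vanishing cycles (equivalently, of critical points), $s$ the number of critical points whose vanishing cycle separates the nearby smooth fibers, $D$ the number of singular fibers, and $N$ the total number of irreducible components of the singular fibers (the closures of the connected components of the singular fibers minus the critical points). Then $k$ and $N$ are finite, and $$N\ \ge\ s+D \qquad\text{and}\qquad N\ \ge\ k-(h-1)D.$$ -/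

import Mathlib

open Set Topology
open scoped Manifold ContDiff

/-- An orientation of a smooth `n`-manifold without boundary: a smooth atlas, contained in the
maximal atlas, all of whose coordinate changes have positive Jacobian determinant. -/
structure SmoothOrientation (n : ℕ) (M : Type*) [TopologicalSpace M]
    [ChartedSpace (EuclideanSpace ℝ (Fin n)) M] where
  charts : Set (OpenPartialHomeomorph M (EuclideanSpace ℝ (Fin n)))
  smooth : charts ⊆ IsManifold.maximalAtlas (𝓡 n) ∞ M
  cover : ∀ x : M, ∃ φ ∈ charts, x ∈ φ.source
  positive : ∀ φ ∈ charts, ∀ ψ ∈ charts, ∀ x ∈ φ.source ∩ ψ.source,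
    0 < (fderiv ℝ (fun v => ψ (φ.symm v)) (φ x)).det

/-- `φ` is an orientation-preserving smooth chart of the oriented manifold `(M, O)`. -/
def SmoothOrientation.IsPositiveChart {n : ℕ} {M : Type*} [TopologicalSpace M]
    [ChartedSpace (EuclideanSpace ℝ (Fin n)) M] (O : SmoothOrientation n M)
    (φ : OpenPartialHomeomorph M (EuclideanSpace ℝ (Fin n))) : Prop :=
  φ ∈ IsManifold.maximalAtlas (𝓡 n) ∞ M ∧
    ∀ ψ ∈ O.charts, ∀ x ∈ φ.source ∩ ψ.source,
      0 < (fderiv ℝ (fun v => ψ (φ.symm v)) (φ x)).det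

/-- The first complex coordinate on `ℝ⁴ = ℂ²`. -/
def coordZ₁ (v : EuclideanSpace ℝ (Fin 4)) : ℂ := ⟨v 0, v 1⟩

/-- The second complex coordinate on `ℝ⁴ = ℂ²`. -/
def coordZ₂ (v : EuclideanSpace ℝ (Fin 4)) : ℂ := ⟨v 2, v 3⟩

/-- The complex coordinate on `ℝ² = ℂ`. -/
def coordW (v : EuclideanSpace ℝ (Fin 2)) : ℂ := ⟨v 0, v 1⟩

section Lefschetz

variable {X B : Type*}
  [TopologicalSpace X] [ChartedSpace (EuclideanSpace ℝ (Fin 4)) X]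
  [TopologicalSpace B] [ChartedSpace (EuclideanSpace ℝ (Fin 2)) B]

/-- The critical points of `f`: the points where the differential is not surjective. -/
def criticalPoints (f : X → B) : Set X :=
  {p | ¬ Function.Surjective (mfderiv (𝓡 4) (𝓡 2) f p)}

/-- The critical values of `f`; the singular fibers are the fibers over these points. -/
def criticalValues (f : X → B) : Set B := f '' criticalPoints f

/-- `(φ, ψ)` is a pair of orientation-preserving charts centred at `p` and `f p`
in which `f` takes the form `(z₁, z₂) ↦ z₁² + z₂²`. -/
structure IsLefschetzChart (OX : SmoothOrientation 4 X) (OB : SmoothOrientation 2 B)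
    (f : X → B) (p : X)
    (φ : OpenPartialHomeomorph X (EuclideanSpace ℝ (Fin 4)))
    (ψ : OpenPartialHomeomorph B (EuclideanSpace ℝ (Fin 2))) : Prop where
  positive_source : OX.IsPositiveChart φ
  positive_target : OB.IsPositiveChart ψ
  mem_source : p ∈ φ.source
  map_zero : φ p = 0
  map_zero' : ψ (f p) = 0
  mapsTo : MapsTo f φ.source ψ.source
  eq : ∀ x ∈ φ.source, coordW (ψ (f x)) = coordZ₁ (φ x) ^ 2 + coordZ₂ (φ x) ^ 2

/-- A Lefschetz fibration from an oriented `4`-manifold to an oriented surface: a smooth map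
with the standard quadratic form near each critical point. Several critical points may lie in
the same fiber. -/
structure IsLefschetzFibration (OX : SmoothOrientation 4 X) (OB : SmoothOrientation 2 B)
    (f : X → B) : Prop where
  smooth : ContMDiff (𝓡 4) (𝓡 2) ∞ f
  local_form : ∀ p ∈ criticalPoints f, ∃ φ ψ, IsLefschetzChart OX OB f p φ ψ

/-- The closed orientable surface `S` (a subspace of `X`) is connected and has genus `h`:
the largest number of pairwise disjoint simple closed curves on `S` whose union has
connected complement is `h`. -/
def HasGenus {X : Type*} [TopologicalSpace X] (S : Set X) (h : ℕ) : Prop :=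
  IsGreatest {n : ℕ | ∃ c : Fin n → Set X,
    (∀ i, c i ⊆ S) ∧ (∀ i, Nonempty (c i ≃ₜ Circle)) ∧
    (∀ i j, i ≠ j → Disjoint (c i) (c j)) ∧
    IsConnected (S \ ⋃ i, c i)} h

/-- The fiber genus of `f` is `h`: the smooth fibers are connected surfaces of genus `h`. -/
def HasFiberGenus (f : X → B) (h : ℕ) : Prop :=
  ∀ b, b ∉ criticalValues f → HasGenus (f ⁻¹' {b}) h

/-- The vanishing cycle in the fiber over `b`, read in a Lefschetz chart `φ`. If
`z₁² + z₂² = t = r e^{2iθ}` on this fiber, then `|z₁|² + |z₂|² = |t|` says that `(z₁, z₂)` is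
`e^{iθ}` times a real vector of length `√r`; this circle shrinks to the critical point as `b`
tends to the critical value. -/
def vanishingCycle (f : X → B) (φ : OpenPartialHomeomorph X (EuclideanSpace ℝ (Fin 4)))
    (b : B) : Set X :=
  {x | x ∈ φ.source ∧ f x = b ∧
    ‖coordZ₁ (φ x)‖ ^ 2 + ‖coordZ₂ (φ x)‖ ^ 2 = ‖coordZ₁ (φ x) ^ 2 + coordZ₂ (φ x) ^ 2‖}

/-- The critical points whose vanishing cycle is separating: its complement in the smooth
fibers close to the singular fiber is disconnected. -/
def separatingPoints (OX : SmoothOrientation 4 X) (OB : SmoothOrientation 2 B)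
    (f : X → B) : Set X :=
  {p | p ∈ criticalPoints f ∧ ∃ φ ψ, IsLefschetzChart OX OB f p φ ψ ∧
    ∀ᶠ b in 𝓝[≠] (f p), ¬ IsPreconnected (f ⁻¹' {b} \ vanishingCycle f φ b)}

/-- The (irreducible) components of the singular fibers: the closures of the connected
components of the singular fibers with the critical points removed. -/
def singularFiberComponents (f : X → B) : Set (Set X) :=
  {C | ∃ b ∈ criticalValues f, ∃ x ∈ f ⁻¹' {b} \ criticalPoints f,
    C = closure (connectedComponentIn (f ⁻¹' {b} \ criticalPoints f) x)}

end Lefschetz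

/-! Both inequalities are sums over singular fibers of local ones. Let `F` be a singular fiber minus
its critical points and `S` a nearby smooth fiber. Away from its vanishing cycles, `S` looks like
`F`, so a function that is locally constant on `S` off the cycles descends to a function on the
components of `F`.

Let `K` be a set of vanishing cycles whose removal leaves `S` connected, and `I` a set of further
cycles, each of which disconnects what remains. Every `p` in `I` gives a locally constant function
on `S` minus `K` and `p` that jumps by 1 across `p` and not at all across the other cycles in `I`.
Together with the constants these are `|I| + 1` linearly independent functions, so `F` has at least
`|I| + 1` components (`FiberComparison.card_lt_ncard`).

With `K` empty and `I` the separating cycles this gives `s + 1` for the fiber. With `K` maximal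
among the sets with connected complement and `I` the remaining cycles, `|K| ≤ h` by the definition
of genus, which gives `k - h + 1`.

The comparison of `F` with `S` (`exists_fiberComparison`) uses the model `uv = t` near critical
points, discs from the implicit function theorem elsewhere, and compactness to keep finitely many
pieces. -/

/-! ### Locally constant functions and separation by a two-sided set -/

theorem IsPreconnected.eq_of_locally_eq {X Y : Type*} [TopologicalSpace X] {s : Set X}
    (hs : IsPreconnected s) (g : X → Y)
    (hg : ∀ x ∈ s, ∃ O, IsOpen O ∧ x ∈ O ∧ ∀ y ∈ O ∩ s, g y = g x)
    {x y : X} (hx : x ∈ s) (hy : y ∈ s) : g x = g y := by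
  refine hs.induction₂' (fun a b => g a = g b) (fun a ha => ?_)
    (fun a b c _ _ _ => Eq.trans) hx hy
  obtain ⟨O, hO, haO, h⟩ := hg a ha
  filter_upwards [mem_nhdsWithin_of_mem_nhds (hO.mem_nhds haO), self_mem_nhdsWithin] with b hb hbs
  exact ⟨(h b ⟨hb, hbs⟩).symm, h b ⟨hb, hbs⟩⟩

/-- If removing a two-sided set `c` disconnects `T`, then some function that is constant on the
connected subsets of `T \ c` distinguishes the two sides of `c`. -/
theorem exists_separating_function {X : Type*} [TopologicalSpace X] {T c A P M : Set X}
    (hT : IsPreconnected T) (hTc : ¬ IsPreconnected (T \ c))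
    (hloc : ∀ x ∈ T \ c, ∃ O, IsOpen O ∧ x ∈ O ∧ IsPreconnected (O ∩ T) ∧ O ∩ T ⊆ T \ c)
    (hA : IsOpen A) (hcA : c ⊆ A) (hAT : A ∩ T ⊆ P ∪ c ∪ M)
    (hP : IsPreconnected P) (hM : IsPreconnected M) (hPT : P ⊆ T \ c) (hMT : M ⊆ T \ c)
    {x y : X} (hx : x ∈ P) (hy : y ∈ M) :
    ∃ u : X → ℝ, (∀ Q ⊆ T \ c, IsPreconnected Q → ∀ a ∈ Q, ∀ b ∈ Q, u a = u b) ∧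
      u x = 1 ∧ u y = 0 := by
  classical
  set C := connectedComponentIn (T \ c) x with hC
  have hxC : x ∈ C := mem_connectedComponentIn (hPT hx)
  have key : ∀ Q ⊆ T \ c, IsPreconnected Q → ∀ a ∈ Q, a ∈ C → Q ⊆ C := by
    intro Q hQ hQc a ha haC
    rw [hC, connectedComponentIn_eq haC]
    exact hQc.subset_connectedComponentIn ha hQ
  refine ⟨C.indicator 1, ?_, by simp [hxC], ?_⟩
  · intro Q hQ hQc a ha b hb
    by_cases haC : a ∈ C
    · have hbC := key Q hQ hQc a ha haC hb
      simp [haC, hbC]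
    · have hbC : b ∉ C := fun h => haC (key Q hQ hQc b hb h ha)
      simp [haC, hbC]
  · refine indicator_of_notMem (fun hyC => hTc ?_) _
    have hPC := key P hPT hP x hx hxC
    have hMC := key M hMT hM y hy hyC
    suffices T \ c ⊆ C by
      rw [this.antisymm (connectedComponentIn_subset _ _)]
      exact isPreconnected_connectedComponentIn
    intro z hz
    by_contra hzC
    -- If both sides of `c` lay in `C`, the collar `A` could be joined to `C`; the traces of `O₁`
    -- and `O₂` would then split the preconnected set `T`.
    let O₁ : Set X := A ∪ ⋃₀ {O | IsOpen O ∧ O ∩ T ⊆ C}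
    let O₂ : Set X := ⋃₀ {O | IsOpen O ∧ O ∩ T ⊆ (T \ c) \ C}
    have h₁ : IsOpen O₁ := hA.union (isOpen_sUnion fun O hO => hO.1)
    have h₂ : IsOpen O₂ := isOpen_sUnion fun O hO => hO.1
    have hin₁ : ∀ a ∈ C, a ∈ O₁ := by
      intro a ha
      obtain ⟨O, hO, haO, hOc, hOT⟩ := hloc a (connectedComponentIn_subset _ _ ha)
      exact Or.inr ⟨O, ⟨hO, key _ hOT hOc a
        ⟨haO, (connectedComponentIn_subset _ _ ha).1⟩ ha⟩, haO⟩
    have hin₂ : ∀ a ∈ (T \ c) \ C, a ∈ O₂ := by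
      intro a ha
      obtain ⟨O, hO, haO, hOc, hOT⟩ := hloc a ha.1
      exact ⟨O, ⟨hO, fun d hd => ⟨hOT hd, fun hdC =>
        ha.2 (key _ hOT hOc d hd hdC ⟨haO, ha.1.1⟩)⟩⟩, haO⟩
    have hcov : T ⊆ O₁ ∪ O₂ := by
      intro a ha
      by_cases hac : a ∈ c
      · exact Or.inl (Or.inl (hcA hac))
      by_cases haC : a ∈ C
      · exact Or.inl (hin₁ a haC)
      · exact Or.inr (hin₂ a ⟨⟨ha, hac⟩, haC⟩)
    obtain ⟨a, haT, ha₁, O, hO, haO⟩ := hT O₁ O₂ h₁ h₂ hcov ⟨x, (hPT hx).1, hin₁ x hxC⟩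
      ⟨z, hz.1, hin₂ z ⟨hz, hzC⟩⟩
    have ha := hO.2 ⟨haO, haT⟩
    rcases ha₁ with haA | ⟨O', hO', haO'⟩
    · rcases hAT ⟨haA, haT⟩ with (h | h) | h
      · exact ha.2 (hPC h)
      · exact ha.1.2 h
      · exact ha.2 (hMC h)
    · exact ha.2 (hO'.2 ⟨haO', haT⟩)

/-! ### Counting components of a singular fiber by linear algebra -/

/-- A finite family of open pieces `V` comparing a singular fiber without its critical points `F`
with a nearby fiber `S` and its disjoint two-sided circles `c`: each piece meets both in connected
sets, and pieces that overlap in `F` overlap in `S`. -/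
structure FiberComparison {X ι κ : Type*} [TopologicalSpace X] (F S : Set X)
    (V : ι → Set X) (c A : κ → Set X) (pos neg : κ → ι) : Prop where
  isOpen_piece : ∀ i, IsOpen (V i)
  piece_inter_singular : ∀ i, IsPreconnected (V i ∩ F)
  piece_nonempty : ∀ i, (V i ∩ F).Nonempty
  cover_singular : F ⊆ ⋃ i, V i
  piece_inter : ∀ i, IsPreconnected (V i ∩ S)
  overlap : ∀ i j, (V i ∩ V j ∩ F).Nonempty → (V i ∩ V j ∩ S).Nonempty
  circle_subset : ∀ p, c p ⊆ S
  disjoint_piece : ∀ i p, Disjoint (V i) (c p)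
  cover : S ⊆ (⋃ i, V i) ∪ ⋃ p, c p
  isOpen_collar : ∀ p, IsOpen (A p)
  circle_subset_collar : ∀ p, c p ⊆ A p
  collar_inter : ∀ p, IsPreconnected (A p ∩ S)
  collar_disjoint : ∀ p q, p ≠ q → Disjoint (A p) (c q)
  collar_subset : ∀ p, A p ∩ S ⊆ V (pos p) ∪ c p ∪ V (neg p)
  pos_subset : ∀ p, V (pos p) ⊆ A p
  neg_subset : ∀ p, V (neg p) ⊆ A p

namespace FiberComparison

variable {X ι κ : Type*} [TopologicalSpace X] {F S : Set X}
    {V : ι → Set X} {c A : κ → Set X} {pos neg : κ → ι}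

theorem piece_inter_nonempty (H : FiberComparison F S V c A pos neg) (i : ι) :
    (V i ∩ S).Nonempty := by
  obtain ⟨x, hx, hxF⟩ := H.piece_nonempty i
  obtain ⟨y, hy, hyS⟩ := H.overlap i i ⟨x, ⟨hx, hx⟩, hxF⟩
  exact ⟨y, hy.1, hyS⟩

theorem piece_subset (H : FiberComparison F S V c A pos neg) (i : ι) (K : Set κ) :
    V i ∩ S ⊆ S \ ⋃ q ∈ K, c q := by
  rintro x ⟨hx, hxS⟩
  refine ⟨hxS, fun h => ?_⟩
  simp only [mem_iUnion] at h
  obtain ⟨q, -, hq⟩ := h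
  exact (H.disjoint_piece i q).le_bot ⟨hx, hq⟩

theorem collar_subset_diff (H : FiberComparison F S V c A pos neg) {p : κ} {K : Set κ}
    (hp : p ∉ K) : A p ∩ S ⊆ S \ ⋃ q ∈ K, c q := by
  rintro x ⟨hx, hxS⟩
  refine ⟨hxS, fun h => ?_⟩
  simp only [mem_iUnion] at h
  obtain ⟨q, hqK, hq⟩ := h
  exact (H.collar_disjoint p q (fun e => hp (e ▸ hqK))).le_bot ⟨hx, hq⟩

theorem exists_nhd (H : FiberComparison F S V c A pos neg) {K : Set κ} {x : X}
    (hx : x ∈ S \ ⋃ q ∈ K, c q) :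
    ∃ O, IsOpen O ∧ x ∈ O ∧ IsPreconnected (O ∩ S) ∧ O ∩ S ⊆ S \ ⋃ q ∈ K, c q := by
  rcases H.cover hx.1 with h | h
  · obtain ⟨i, hi⟩ := mem_iUnion.1 h
    exact ⟨V i, H.isOpen_piece i, hi, H.piece_inter i, H.piece_subset i K⟩
  · obtain ⟨p, hp⟩ := mem_iUnion.1 h
    have hpK : p ∉ K := fun hpK => hx.2 (mem_biUnion hpK hp)
    exact ⟨A p, H.isOpen_collar p, H.circle_subset_collar p hp, H.collar_inter p,
      H.collar_subset_diff hpK⟩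

/-- The jump function of a circle `p` that separates `S` minus `K`: the indicator of the component
containing the positive side. The pieces and collars supply the local connectedness needed. -/
theorem exists_separating (H : FiberComparison F S V c A pos neg) {K : Set κ} {p : κ}
    (hT : IsPreconnected (S \ ⋃ q ∈ K, c q))
    (hTp : ¬ IsPreconnected (S \ ⋃ q ∈ insert p K, c q)) :
    ∃ u : X → ℝ, (∀ Q ⊆ S \ ⋃ q ∈ insert p K, c q, IsPreconnected Q →
        ∀ a ∈ Q, ∀ b ∈ Q, u a = u b) ∧
      ∀ x ∈ V (pos p) ∩ S, ∀ y ∈ V (neg p) ∩ S, u x - u y = 1 := by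
  have hdiff : S \ ⋃ q ∈ insert p K, c q = (S \ ⋃ q ∈ K, c q) \ c p := by
    rw [biUnion_insert, union_comm, sdiff_sdiff]
  obtain ⟨x, hx⟩ := H.piece_inter_nonempty (pos p)
  obtain ⟨y, hy⟩ := H.piece_inter_nonempty (neg p)
  have hP := H.piece_subset (pos p) (insert p K)
  have hM := H.piece_subset (neg p) (insert p K)
  obtain ⟨u, hu, hux, huy⟩ := exists_separating_function (T := S \ ⋃ q ∈ K, c q) (c := c p)
    (A := A p) (P := V (pos p) ∩ S) (M := V (neg p) ∩ S) hT (hdiff ▸ hTp) (by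
      intro x hx
      obtain ⟨O, hO, hxO, hOc, hOs⟩ := H.exists_nhd (K := insert p K) (hdiff ▸ hx)
      have e : O ∩ (S \ ⋃ q ∈ K, c q) = O ∩ S := by
        refine Subset.antisymm (inter_subset_inter_right _ sdiff_subset) (fun z hz => ⟨hz.1, ?_⟩)
        exact (hdiff ▸ hOs hz : z ∈ _ \ c p).1
      exact ⟨O, hO, hxO, e ▸ hOc, e ▸ hdiff ▸ hOs⟩)
    (H.isOpen_collar p) (H.circle_subset_collar p)
    (by
      rintro z ⟨hz, hzS, -⟩
      rcases H.collar_subset p ⟨hz, hzS⟩ with (h | h) | h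
      · exact Or.inl (Or.inl ⟨h, hzS⟩)
      · exact Or.inl (Or.inr h)
      · exact Or.inr ⟨h, hzS⟩)
    (H.piece_inter _) (H.piece_inter _) (hdiff ▸ hP) (hdiff ▸ hM) hx hy
  rw [← hdiff] at hu
  refine ⟨u, hu, fun a ha b hb => ?_⟩
  rw [hu _ hP (H.piece_inter _) a ha x hx, hu _ hM (H.piece_inter _) b hb y hy, hux, huy, sub_zero]

/-- The closures of the components of `F`. -/
def componentClosures (F : Set X) : Set (Set X) :=
  {C | ∃ x ∈ F, C = closure (connectedComponentIn F x)}

/-- Each piece meets `F` in a connected set, hence in a single component, and there are finitely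
many pieces. -/
theorem finite_componentClosures [Finite ι] (H : FiberComparison F S V c A pos neg) :
    (componentClosures F).Finite := by
  choose y hy using H.piece_nonempty
  refine (finite_range fun i => closure (connectedComponentIn F (y i))).subset ?_
  rintro C ⟨x, hx, rfl⟩
  obtain ⟨i, hi⟩ := mem_iUnion.1 (H.cover_singular hx)
  refine ⟨i, congrArg closure (connectedComponentIn_eq ?_)⟩
  exact (H.piece_inter_singular i).subset_connectedComponentIn (hy i) inter_subset_right ⟨hi, hx⟩

/-- A function on the pieces that agrees on overlapping pieces and vanishes on pieces meeting every
component of `F` vanishes. -/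
theorem eq_zero_of_overlap (H : FiberComparison F S V c A pos neg) (w : ι → ℝ)
    (hw : ∀ i j, (V i ∩ V j ∩ F).Nonempty → w i = w j)
    (h0 : ∀ C ∈ componentClosures F, ∃ x ∈ F, C = closure (connectedComponentIn F x) ∧
      ∃ i, x ∈ V i ∧ w i = 0) (i : ι) : w i = 0 := by
  classical
  have hcov : ∀ x ∈ F, ∃ i, x ∈ V i := fun x hx => mem_iUnion.1 (H.cover_singular hx)
  let g : X → ℝ := fun x => if hx : x ∈ F then w (hcov x hx).choose else 0
  have hg : ∀ x ∈ F, ∀ j, x ∈ V j → g x = w j := by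
    intro x hx j hj
    simp only [g, dif_pos hx]
    exact hw _ _ ⟨x, ⟨(hcov x hx).choose_spec, hj⟩, hx⟩
  obtain ⟨x, hxi, hx⟩ := H.piece_nonempty i
  obtain ⟨x', hx', hC, j, hj, hwj⟩ := h0 _ ⟨x, hx, rfl⟩
  -- Only the closures of the components of `x` and `x'` are known to agree. Since `V i` is open, it
  -- nevertheless meets the component of `x'` itself, along which `g` is constant.
  have hxc : x ∈ closure (connectedComponentIn F x') :=
    hC ▸ subset_closure (mem_connectedComponentIn hx)
  obtain ⟨z, hzi, hz⟩ := mem_closure_iff.1 hxc (V i) (H.isOpen_piece i) hxi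
  have hzF := connectedComponentIn_subset _ _ hz
  rw [← hg z hzF i hzi, ← hwj, ← hg x' hx' j hj]
  refine isPreconnected_connectedComponentIn.eq_of_locally_eq g (fun a ha => ?_) hz
    (mem_connectedComponentIn hx')
  have haF := connectedComponentIn_subset _ _ ha
  obtain ⟨l, hl⟩ := hcov a haF
  exact ⟨V l, H.isOpen_piece l, hl, fun b hb => by
    rw [hg a haF l hl, hg b (connectedComponentIn_subset _ _ hb.2) l hb.1]⟩

/-- If `S` minus the circles in `K` is connected and each circle in `I` separates it, then `F` has
at least `|I| + 1` components. -/
theorem card_lt_ncard [Finite ι] [Nonempty ι] (H : FiberComparison F S V c A pos neg)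
    (K : Set κ) (I : Finset κ) (hKI : ∀ p ∈ I, p ∉ K)
    (hT : IsPreconnected (S \ ⋃ q ∈ K, c q))
    (hTp : ∀ p ∈ I, ¬ IsPreconnected (S \ ⋃ q ∈ insert p K, c q)) :
    I.card + 1 ≤ (componentClosures F).ncard := by
  classical
  have hfin := H.finite_componentClosures
  have := hfin.fintype
  choose u hu hu1 using fun p : I => H.exists_separating hT (hTp p p.2)
  choose y hy using H.piece_inter_nonempty
  have hrep : ∀ C : componentClosures F, ∃ i, ∃ x ∈ F,
      C.1 = closure (connectedComponentIn F x) ∧ x ∈ V i := by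
    rintro ⟨C, x, hx, rfl⟩
    obtain ⟨i, hi⟩ := mem_iUnion.1 (H.cover_singular hx)
    exact ⟨i, x, hx, rfl, hi⟩
  choose r hr using hrep
  -- A combination of the constant function (index `none`) and the jump functions, sampled at one
  -- point of `S` in each piece.
  let W : (Option I → ℝ) →ₗ[ℝ] (ι → ℝ) :=
    { toFun := fun a i => a none + ∑ p : I, a (some p) * u p (y i)
      map_add' := fun a b => by
        ext i
        simp only [Pi.add_apply, add_mul, Finset.sum_add_distrib]
        ring
      map_smul' := fun t a => by
        ext i
        simp only [Pi.smul_apply, smul_eq_mul, RingHom.id_apply, mul_add, Finset.mul_sum,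
          mul_assoc] }
  have hWinj : ∀ a, W a = 0 → a = 0 := by
    intro a ha
    -- Compare the two sides of `p`: `u p` jumps by 1, while for `q ≠ p` the function `u q` is
    -- constant on the connected collar of `p`, which avoids `q` and `K`.
    have hsome : ∀ p : I, a (some p) = 0 := by
      intro p
      have h := sub_eq_zero.2 ((congrFun ha (pos p)).trans (congrFun ha (neg p)).symm)
      simp only [W, LinearMap.coe_mk, AddHom.coe_mk, add_sub_add_left_eq_sub,
        ← Finset.sum_sub_distrib, ← mul_sub] at h
      rw [Finset.sum_eq_single p, hu1 p _ (hy _) _ (hy _), mul_one] at h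
      · exact h
      · intro q _ hqp
        have hpq : (p : κ) ≠ q := fun e => hqp (Subtype.ext e.symm)
        have hp : (p : κ) ∉ insert (q : κ) K := by
          rintro (h | h)
          · exact hpq h
          · exact hKI p p.2 h
        rw [hu q (A p ∩ S) (H.collar_subset_diff hp) (H.collar_inter p) (y (pos p))
          ⟨H.pos_subset p (hy _).1, (hy _).2⟩ (y (neg p)) ⟨H.neg_subset p (hy _).1, (hy _).2⟩,
          sub_self, mul_zero]
      · simp
    ext o
    rcases o with _ | p
    · have h := congrFun ha (Classical.arbitrary ι)
      simpa [W, hsome] using h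
    · exact hsome p
  -- Sampling at one piece per component closure loses nothing: pieces overlapping in `F` also
  -- overlap in `S`, so `W a` agrees on them and is determined along each component.
  let R : (Option I → ℝ) →ₗ[ℝ] (componentClosures F → ℝ) := (LinearMap.funLeft ℝ ℝ r).comp W
  have hR : Function.Injective R := by
    rw [← LinearMap.ker_eq_bot, LinearMap.ker_eq_bot']
    intro a ha
    refine hWinj a (funext fun i => H.eq_zero_of_overlap (W a) ?_ ?_ i)
    · intro i j hij
      obtain ⟨z, ⟨hzi, hzj⟩, hzS⟩ := H.overlap i j hij
      have : ∀ p : I, u p (y i) = u p (y j) := fun p =>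
        (hu p _ (H.piece_subset i _) (H.piece_inter i) _ (hy i) z ⟨hzi, hzS⟩).trans
          (hu p _ (H.piece_subset j _) (H.piece_inter j) z ⟨hzj, hzS⟩ _ (hy j))
      simp [W, this]
    · intro C hC
      obtain ⟨x, hx, e, hxi⟩ := hr ⟨C, hC⟩
      exact ⟨x, hx, e, _, hxi, congrFun ha ⟨C, hC⟩⟩
  have := LinearMap.finrank_le_finrank_of_injective hR
  rw [Module.finrank_fintype_fun_eq_card, Module.finrank_fintype_fun_eq_card, Fintype.card_option,
    Fintype.card_coe] at this
  rwa [← Nat.card_coe_set_eq, Nat.card_eq_fintype_card]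

end FiberComparison

/-! ### The local model `uv = t` in null coordinates -/

/-- The null coordinate `z₁ + i z₂` on `ℝ⁴ = ℂ²`. -/
noncomputable def coordU (v : EuclideanSpace ℝ (Fin 4)) : ℂ := coordZ₁ v + Complex.I * coordZ₂ v

/-- The null coordinate `z₁ - i z₂` on `ℝ⁴ = ℂ²`. -/
noncomputable def coordV (v : EuclideanSpace ℝ (Fin 4)) : ℂ := coordZ₁ v - Complex.I * coordZ₂ v

/-- The point of `ℝ⁴` with given null coordinates. -/
noncomputable def ofNull (q : ℂ × ℂ) : EuclideanSpace ℝ (Fin 4) :=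
  !₂[(q.1.re + q.2.re) / 2, (q.1.im + q.2.im) / 2, (q.1.im - q.2.im) / 2, (q.2.re - q.1.re) / 2]

theorem coordU_mul_coordV (v : EuclideanSpace ℝ (Fin 4)) :
    coordU v * coordV v = coordZ₁ v ^ 2 + coordZ₂ v ^ 2 := by
  simp only [coordU, coordV]
  linear_combination (-coordZ₂ v ^ 2) * Complex.I_sq

theorem sq_norm_coordZ (v : EuclideanSpace ℝ (Fin 4)) :
    ‖coordZ₁ v‖ ^ 2 + ‖coordZ₂ v‖ ^ 2 = ‖v‖ ^ 2 := by
  rw [EuclideanSpace.real_norm_sq_eq, Complex.sq_norm, Complex.sq_norm, Complex.normSq_apply,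
    Complex.normSq_apply, Fin.sum_univ_four]
  simp only [coordZ₁, coordZ₂]
  ring

theorem sq_norm_coordU_add (v : EuclideanSpace ℝ (Fin 4)) :
    ‖coordU v‖ ^ 2 + ‖coordV v‖ ^ 2 = 2 * ‖v‖ ^ 2 := by
  rw [EuclideanSpace.real_norm_sq_eq, Complex.sq_norm, Complex.sq_norm, Complex.normSq_apply,
    Complex.normSq_apply, Fin.sum_univ_four]
  simp [coordU, coordV, coordZ₁, coordZ₂]
  ring

theorem coordU_ofNull (q : ℂ × ℂ) : coordU (ofNull q) = q.1 := by
  apply Complex.ext <;> simp [coordU, coordZ₁, coordZ₂, ofNull] <;> ring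

theorem coordV_ofNull (q : ℂ × ℂ) : coordV (ofNull q) = q.2 := by
  apply Complex.ext <;> simp [coordV, coordZ₁, coordZ₂, ofNull] <;> ring

theorem ofNull_coord (v : EuclideanSpace ℝ (Fin 4)) : ofNull (coordU v, coordV v) = v := by
  ext i
  fin_cases i <;> simp [coordU, coordV, coordZ₁, coordZ₂, ofNull]
  ring

theorem continuous_coordZ₁ : Continuous coordZ₁ := by
  have : coordZ₁ = fun v => Complex.equivRealProdCLM.symm (v 0, v 1) := by
    ext v; simp [coordZ₁, Complex.ext_iff]
  rw [this]; fun_prop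

theorem continuous_coordZ₂ : Continuous coordZ₂ := by
  have : coordZ₂ = fun v => Complex.equivRealProdCLM.symm (v 2, v 3) := by
    ext v; simp [coordZ₂, Complex.ext_iff]
  rw [this]; fun_prop

theorem continuous_coordW : Continuous coordW := by
  have : coordW = fun v => Complex.equivRealProdCLM.symm (v 0, v 1) := by
    ext v; simp [coordW, Complex.ext_iff]
  rw [this]; fun_prop

theorem coordW_injective : Function.Injective coordW := by
  intro v w h
  rw [coordW, coordW, Complex.mk.injEq] at h
  ext i
  fin_cases i
  exacts [h.1, h.2]

theorem coordW_zero : coordW 0 = 0 := by simp [coordW, Complex.ext_iff]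

theorem continuous_coordU : Continuous coordU :=
  continuous_coordZ₁.add (continuous_const.mul continuous_coordZ₂)

theorem continuous_coordV : Continuous coordV :=
  continuous_coordZ₁.sub (continuous_const.mul continuous_coordZ₂)

theorem continuous_ofNull : Continuous ofNull := by
  refine (PiLp.continuous_toLp 2 _).comp (continuous_pi fun i => ?_)
  fin_cases i <;> simp <;> fun_prop

/-- The circle condition `|z₁|² + |z₂|² = |z₁² + z₂²|` in null coordinates. -/
theorem circle_condition_iff (v : EuclideanSpace ℝ (Fin 4)) :
    ‖coordZ₁ v‖ ^ 2 + ‖coordZ₂ v‖ ^ 2 = ‖coordZ₁ v ^ 2 + coordZ₂ v ^ 2‖ ↔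
      ‖coordU v‖ = ‖coordV v‖ := by
  rw [sq_norm_coordZ, ← coordU_mul_coordV, norm_mul]
  have h := sq_norm_coordU_add v
  constructor
  · intro e
    have : (‖coordU v‖ - ‖coordV v‖) ^ 2 = 0 := by nlinarith
    exact sub_eq_zero.1 (pow_eq_zero_iff two_ne_zero |>.1 this)
  · intro e
    rw [e] at h ⊢
    linarith

/-- With `u = exp z`, `v = t exp (-z)`, `s = Re z` and `a = ‖t‖ ^ 2`, this is the condition `‖u‖ ^ 2
+ ‖v‖ ^ 2 < r`. It is a sublevel set of a convex function. -/
theorem convex_exp_add_lt (a r : ℝ) (ha : 0 ≤ a) :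
    Convex ℝ {s : ℝ | Real.exp (2 * s) + a * Real.exp (-(2 * s)) < r} := by
  have h₁ : ConvexOn ℝ univ fun s : ℝ => Real.exp (2 * s) :=
    convexOn_exp.comp_linearMap (LinearMap.lsmul ℝ ℝ 2)
  have h₂ : ConvexOn ℝ univ fun s : ℝ => Real.exp (-(2 * s)) :=
    convexOn_exp.comp_linearMap (-LinearMap.lsmul ℝ ℝ (2 : ℝ))
  simpa using (h₁.add (h₂.smul ha)).convex_lt r

theorem norm_exp_sq (z : ℂ) : ‖Complex.exp z‖ ^ 2 = Real.exp (2 * z.re) := by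
  rw [Complex.norm_exp, ← Real.exp_nat_mul]; norm_num

/-- The set is the image of a convex vertical strip under `z ↦ (exp z, t exp (-z))`. For `t = 0`
this parametrization would miss the axis `u = 0`. -/
theorem isPreconnected_hyperbola {t : ℂ} (ht : t ≠ 0) (r : ℝ) :
    IsPreconnected {q : ℂ × ℂ | q.1 * q.2 = t ∧ ‖q.1‖ ^ 2 + ‖q.2‖ ^ 2 < r} := by
  have hc : Convex ℝ (Complex.reLm ⁻¹'
      {s : ℝ | Real.exp (2 * s) + ‖t‖ ^ 2 * Real.exp (-(2 * s)) < r}) :=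
    (convex_exp_add_lt _ r (sq_nonneg _)).linear_preimage _
  convert hc.isPreconnected.image (fun z => (Complex.exp z, t * Complex.exp (-z)))
    (by fun_prop) using 1
  have hn : ∀ z, ‖t * Complex.exp (-z)‖ ^ 2 = ‖t‖ ^ 2 * Real.exp (-(2 * z.re)) := by
    intro z; rw [norm_mul, mul_pow, norm_exp_sq]; simp
  ext ⟨u, w⟩
  constructor
  · rintro ⟨h, hr⟩
    simp only at h hr
    have hu : u ≠ 0 := by rintro rfl; exact ht (by simpa using h.symm)
    have hw : t * Complex.exp (-Complex.log u) = w := by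
      rw [Complex.exp_neg, Complex.exp_log hu, ← h]; field_simp
    refine ⟨Complex.log u, ?_, Prod.ext (Complex.exp_log hu) hw⟩
    change Real.exp (2 * (Complex.log u).re) + _ * Real.exp (-(2 * (Complex.log u).re)) < r
    rw [← hn, hw, ← norm_exp_sq, Complex.exp_log hu]
    exact hr
  · rintro ⟨z, hz, e⟩
    obtain ⟨rfl, rfl⟩ := Prod.mk.injEq _ _ _ _ ▸ e
    refine ⟨?_, ?_⟩
    · simp only
      rw [mul_left_comm, ← Complex.exp_add]; simp
    · simp only
      rw [hn, norm_exp_sq]; exact hz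

/-- The same parametrization now works for `t = 0` too, since `‖v‖ < ‖u‖` forces `u ≠ 0`. Hence one
statement serves both the half-annuli of smooth fibers and the punctured discs of the singular
fiber. -/
theorem isPreconnected_hyperbola_half (t : ℂ) (r : ℝ) :
    IsPreconnected {q : ℂ × ℂ | q.1 * q.2 = t ∧ ‖q.1‖ ^ 2 + ‖q.2‖ ^ 2 < r ∧ ‖q.2‖ < ‖q.1‖} := by
  have ho : Convex ℝ {s : ℝ | ‖t‖ < Real.exp (2 * s)} := by
    refine OrdConnected.convex ⟨fun a ha b _ c hc => ?_⟩
    exact lt_of_lt_of_le ha (Real.exp_le_exp.2 (by linarith [hc.1]))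
  have hc : Convex ℝ (Complex.reLm ⁻¹'
      ({s : ℝ | Real.exp (2 * s) + ‖t‖ ^ 2 * Real.exp (-(2 * s)) < r} ∩
        {s : ℝ | ‖t‖ < Real.exp (2 * s)})) :=
    ((convex_exp_add_lt _ r (sq_nonneg _)).inter ho).linear_preimage _
  convert hc.isPreconnected.image (fun z => (Complex.exp z, t * Complex.exp (-z)))
    (by fun_prop) using 1
  have hn : ∀ z, ‖t * Complex.exp (-z)‖ ^ 2 = ‖t‖ ^ 2 * Real.exp (-(2 * z.re)) := by
    intro z; rw [norm_mul, mul_pow, norm_exp_sq]; simp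
  have hlt : ∀ z : ℂ, ‖t * Complex.exp (-z)‖ < ‖Complex.exp z‖ ↔ ‖t‖ < Real.exp (2 * z.re) := by
    intro z
    rw [norm_mul, Complex.exp_neg, norm_inv, ← div_eq_mul_inv,
      div_lt_iff₀ (norm_pos_iff.2 (Complex.exp_ne_zero z)), ← sq, norm_exp_sq]
  ext ⟨u, w⟩
  constructor
  · rintro ⟨h, hr, hl⟩
    simp only at h hr hl
    have hu : u ≠ 0 := by
      rintro rfl
      exact absurd hl (by simp)
    have hw : t * Complex.exp (-Complex.log u) = w := by
      rw [Complex.exp_neg, Complex.exp_log hu, ← h]; field_simp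
    refine ⟨Complex.log u, ⟨?_, ?_⟩, Prod.ext (Complex.exp_log hu) hw⟩
    · change Real.exp (2 * (Complex.log u).re) + _ * Real.exp (-(2 * (Complex.log u).re)) < r
      rw [← hn, hw, ← norm_exp_sq, Complex.exp_log hu]
      exact hr
    · change ‖t‖ < Real.exp (2 * (Complex.log u).re)
      rwa [← hlt, hw, Complex.exp_log hu]
  · rintro ⟨z, ⟨hz, hz'⟩, e⟩
    obtain ⟨rfl, rfl⟩ := Prod.mk.injEq _ _ _ _ ▸ e
    refine ⟨?_, ?_, (hlt z).2 hz'⟩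
    · simp only
      rw [mul_left_comm, ← Complex.exp_add]; simp
    · simp only
      rw [hn, norm_exp_sq]; exact hz

theorem isPreconnected_hyperbola_half' (t : ℂ) (r : ℝ) :
    IsPreconnected {q : ℂ × ℂ | q.1 * q.2 = t ∧ ‖q.1‖ ^ 2 + ‖q.2‖ ^ 2 < r ∧ ‖q.1‖ < ‖q.2‖} := by
  convert (isPreconnected_hyperbola_half t r).image Prod.swap continuous_swap.continuousOn using 1
  rw [Set.image_swap_eq_preimage_swap]
  ext q
  simp [mul_comm, add_comm]

/-! ### Milnor balls and their two sides -/

section MilnorBall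

variable {X : Type*} [TopologicalSpace X]

/-- The ball of radius `√(r / 2)` in a Lefschetz chart, in null coordinates. -/
def milnorBall (φ : OpenPartialHomeomorph X (EuclideanSpace ℝ (Fin 4))) (r : ℝ) : Set X :=
  {x | x ∈ φ.source ∧ ‖coordU (φ x)‖ ^ 2 + ‖coordV (φ x)‖ ^ 2 < r}

/-- One side of the vanishing cycles in a Milnor ball. -/
def milnorPos (φ : OpenPartialHomeomorph X (EuclideanSpace ℝ (Fin 4))) (r : ℝ) : Set X :=
  {x | x ∈ φ.source ∧ ‖coordU (φ x)‖ ^ 2 + ‖coordV (φ x)‖ ^ 2 < r ∧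
    ‖coordV (φ x)‖ < ‖coordU (φ x)‖}

/-- The other side of the vanishing cycles in a Milnor ball. -/
def milnorNeg (φ : OpenPartialHomeomorph X (EuclideanSpace ℝ (Fin 4))) (r : ℝ) : Set X :=
  {x | x ∈ φ.source ∧ ‖coordU (φ x)‖ ^ 2 + ‖coordV (φ x)‖ ^ 2 < r ∧
    ‖coordU (φ x)‖ < ‖coordV (φ x)‖}

/-- The closed concentric ball of half the squared radius. -/
def milnorCore (φ : OpenPartialHomeomorph X (EuclideanSpace ℝ (Fin 4))) (r : ℝ) : Set X :=
  {x | x ∈ φ.source ∧ ‖coordU (φ x)‖ ^ 2 + ‖coordV (φ x)‖ ^ 2 ≤ r / 2}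

variable {φ : OpenPartialHomeomorph X (EuclideanSpace ℝ (Fin 4))} {r : ℝ}

theorem continuous_normU : Continuous fun v => ‖coordU v‖ := continuous_coordU.norm

theorem continuous_normV : Continuous fun v => ‖coordV v‖ := continuous_coordV.norm

theorem isOpen_milnorBall : IsOpen (milnorBall φ r) :=
  φ.isOpen_inter_preimage (isOpen_lt ((continuous_normU.pow 2).add (continuous_normV.pow 2))
    continuous_const)

theorem isOpen_milnorPos : IsOpen (milnorPos φ r) :=
  φ.isOpen_inter_preimage ((isOpen_lt ((continuous_normU.pow 2).add (continuous_normV.pow 2))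
    continuous_const).inter (isOpen_lt continuous_normV continuous_normU))

theorem isOpen_milnorNeg : IsOpen (milnorNeg φ r) :=
  φ.isOpen_inter_preimage ((isOpen_lt ((continuous_normU.pow 2).add (continuous_normV.pow 2))
    continuous_const).inter (isOpen_lt continuous_normU continuous_normV))

theorem milnorPos_subset : milnorPos φ r ⊆ milnorBall φ r := fun _ h => ⟨h.1, h.2.1⟩

theorem milnorNeg_subset : milnorNeg φ r ⊆ milnorBall φ r := fun _ h => ⟨h.1, h.2.1⟩

/-- The core is the image under `φ.symm` of a compact ball inside the chart target, hence compact,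
and closed because `X` is Hausdorff. -/
theorem isClosed_milnorCore [T2Space X] (hr : 0 < r)
    (ht : ∀ v, ‖coordU v‖ ^ 2 + ‖coordV v‖ ^ 2 < r → v ∈ φ.target) :
    IsClosed (milnorCore φ r) := by
  let K : Set (EuclideanSpace ℝ (Fin 4)) := {v | ‖coordU v‖ ^ 2 + ‖coordV v‖ ^ 2 ≤ r / 2}
  have hK : IsCompact K := by
    refine Metric.isCompact_of_isClosed_isBounded (isClosed_le
      ((continuous_normU.pow 2).add (continuous_normV.pow 2)) continuous_const) ?_
    refine (Metric.isBounded_closedBall (x := 0) (r := 1 + r)).subset fun v hv => ?_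
    rw [mem_closedBall_zero_iff]
    have hv' : ‖coordU v‖ ^ 2 + ‖coordV v‖ ^ 2 ≤ r / 2 := hv
    rw [sq_norm_coordU_add] at hv'
    nlinarith [norm_nonneg v, sq_nonneg (‖v‖ - 1)]
  have hKt : K ⊆ φ.target := fun v hv => ht v (lt_of_le_of_lt hv (by linarith))
  have : milnorCore φ r = φ.symm '' K := by
    ext x
    constructor
    · rintro ⟨hx, h⟩
      exact ⟨φ x, h, φ.left_inv hx⟩
    · rintro ⟨v, hv, rfl⟩
      refine ⟨φ.map_target (hKt hv), ?_⟩
      rw [φ.right_inv (hKt hv)]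
      exact hv
  rw [this]
  exact (hK.image_of_continuousOn (φ.continuousOn_symm.mono hKt)).isClosed

theorem mem_vanishingCycle_iff {B : Type*} {f : X → B} {b : B} {x : X} : x ∈ vanishingCycle f φ b ↔
    x ∈ φ.source ∧ f x = b ∧ ‖coordU (φ x)‖ = ‖coordV (φ x)‖ := by
  rw [vanishingCycle, mem_ofPred_eq, circle_condition_iff]

end MilnorBall

/-! ### Fibers and vanishing cycles in a Lefschetz chart -/

section

variable {X B : Type*}
  [TopologicalSpace X] [ChartedSpace (EuclideanSpace ℝ (Fin 4)) X]
  [TopologicalSpace B] [ChartedSpace (EuclideanSpace ℝ (Fin 2)) B]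
  {OX : SmoothOrientation 4 X} {OB : SmoothOrientation 2 B} {f : X → B} {p : X}
  {φ : OpenPartialHomeomorph X (EuclideanSpace ℝ (Fin 4))}
  {ψ : OpenPartialHomeomorph B (EuclideanSpace ℝ (Fin 2))}

namespace IsLefschetzChart

theorem mul_eq (h : IsLefschetzChart OX OB f p φ ψ) {x : X} (hx : x ∈ φ.source) :
    coordU (φ x) * coordV (φ x) = coordW (ψ (f x)) := by
  rw [coordU_mul_coordV, h.eq x hx]

theorem eq_iff (h : IsLefschetzChart OX OB f p φ ψ) {x : X} {b : B} (hx : x ∈ φ.source)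
    (hb : b ∈ ψ.source) : f x = b ↔ coordU (φ x) * coordV (φ x) = coordW (ψ b) := by
  rw [h.mul_eq hx]
  exact ⟨fun e => e ▸ rfl, fun e => ψ.injOn (h.mapsTo hx) hb (coordW_injective e)⟩

theorem apply_mem_source (h : IsLefschetzChart OX OB f p φ ψ) : f p ∈ ψ.source :=
  h.mapsTo h.mem_source

theorem coordW_ne_zero (h : IsLefschetzChart OX OB f p φ ψ) {b : B} (hb : b ∈ ψ.source)
    (hne : b ≠ f p) : coordW (ψ b) ≠ 0 := by
  intro e
  refine hne (ψ.injOn hb h.apply_mem_source (coordW_injective ?_))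
  rw [e, h.map_zero', coordW_zero]

/-- Transfers connectedness from the model `uv = t` to a fiber of `f`. -/
theorem isPreconnected_slice (h : IsLefschetzChart OX OB f p φ ψ) {b : B} (hb : b ∈ ψ.source)
    (Q : ℂ × ℂ → Prop) (hQ : ∀ v, Q (coordU v, coordV v) → v ∈ φ.target)
    (hpre : IsPreconnected {q : ℂ × ℂ | q.1 * q.2 = coordW (ψ b) ∧ Q q}) :
    IsPreconnected ({x | x ∈ φ.source ∧ Q (coordU (φ x), coordV (φ x))} ∩ f ⁻¹' {b}) := by
  have hmem : ∀ q, Q q → ofNull q ∈ φ.target := fun q hq => hQ _ (by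
    rwa [coordU_ofNull, coordV_ofNull])
  convert hpre.image (φ.symm ∘ ofNull) (φ.continuousOn_symm.comp continuous_ofNull.continuousOn
    fun q hq => hmem q hq.2) using 1
  ext x
  constructor
  · rintro ⟨⟨hx, hxQ⟩, hxb⟩
    refine ⟨(coordU (φ x), coordV (φ x)), ⟨(h.eq_iff hx hb).1 hxb, hxQ⟩, ?_⟩
    simp [ofNull_coord, φ.left_inv hx]
  · rintro ⟨q, ⟨hq, hqQ⟩, rfl⟩
    have hs := φ.map_target (hmem q hqQ)
    simp only [Function.comp_apply]
    refine ⟨⟨hs, ?_⟩, (h.eq_iff hs hb).2 ?_⟩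
    · rwa [φ.right_inv (hmem q hqQ), coordU_ofNull, coordV_ofNull]
    · rwa [φ.right_inv (hmem q hqQ), coordU_ofNull, coordV_ofNull]

theorem isPreconnected_milnorBall (h : IsLefschetzChart OX OB f p φ ψ) {b : B}
    (hb : b ∈ ψ.source) (hne : b ≠ f p) {r : ℝ}
    (hr : ∀ v, ‖coordU v‖ ^ 2 + ‖coordV v‖ ^ 2 < r → v ∈ φ.target) :
    IsPreconnected (milnorBall φ r ∩ f ⁻¹' {b}) :=
  h.isPreconnected_slice hb (fun q => ‖q.1‖ ^ 2 + ‖q.2‖ ^ 2 < r) hr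
    (isPreconnected_hyperbola (h.coordW_ne_zero hb hne) r)

theorem isPreconnected_milnorPos (h : IsLefschetzChart OX OB f p φ ψ) {b : B}
    (hb : b ∈ ψ.source) {r : ℝ}
    (hr : ∀ v, ‖coordU v‖ ^ 2 + ‖coordV v‖ ^ 2 < r → v ∈ φ.target) :
    IsPreconnected (milnorPos φ r ∩ f ⁻¹' {b}) :=
  h.isPreconnected_slice hb (fun q => ‖q.1‖ ^ 2 + ‖q.2‖ ^ 2 < r ∧ ‖q.2‖ < ‖q.1‖)
    (fun v hv => hr v hv.1) (isPreconnected_hyperbola_half _ r)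

theorem isPreconnected_milnorNeg (h : IsLefschetzChart OX OB f p φ ψ) {b : B}
    (hb : b ∈ ψ.source) {r : ℝ}
    (hr : ∀ v, ‖coordU v‖ ^ 2 + ‖coordV v‖ ^ 2 < r → v ∈ φ.target) :
    IsPreconnected (milnorNeg φ r ∩ f ⁻¹' {b}) :=
  h.isPreconnected_slice hb (fun q => ‖q.1‖ ^ 2 + ‖q.2‖ ^ 2 < r ∧ ‖q.1‖ < ‖q.2‖)
    (fun v hv => hr v hv.1) (isPreconnected_hyperbola_half' _ r)

theorem exists_mem_fiber (h : IsLefschetzChart OX OB f p φ ψ) {q : ℂ × ℂ} (hq : q.1 * q.2 = 0)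
    (ht : ofNull q ∈ φ.target) :
    ∃ x ∈ φ.source, coordU (φ x) = q.1 ∧ coordV (φ x) = q.2 ∧ f x = f p := by
  have hs := φ.map_target ht
  refine ⟨φ.symm (ofNull q), hs, ?_, ?_, (h.eq_iff hs h.apply_mem_source).2 ?_⟩
  · rw [φ.right_inv ht, coordU_ofNull]
  · rw [φ.right_inv ht, coordV_ofNull]
  · rw [φ.right_inv ht, coordU_ofNull, coordV_ofNull, hq, h.map_zero', coordW_zero]

theorem milnorPos_nonempty (h : IsLefschetzChart OX OB f p φ ψ) {r : ℝ} (hr0 : 0 < r)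
    (hr : ∀ v, ‖coordU v‖ ^ 2 + ‖coordV v‖ ^ 2 < r → v ∈ φ.target) :
    (milnorPos φ r ∩ f ⁻¹' {f p}).Nonempty := by
  have hs : 0 < √(r / 2) := Real.sqrt_pos.2 (by linarith)
  have h2 : √(r / 2) ^ 2 = r / 2 := Real.sq_sqrt (by linarith)
  have hn : ‖((√(r / 2) : ℝ) : ℂ)‖ = √(r / 2) := by
    rw [Complex.norm_real, Real.norm_of_nonneg hs.le]
  obtain ⟨x, hx, hu, hv, hf⟩ := h.exists_mem_fiber (q := ((√(r / 2) : ℝ), 0)) (by simp)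
    (hr _ (by rw [coordU_ofNull, coordV_ofNull, hn, h2]; simp; linarith))
  refine ⟨x, ⟨hx, ?_⟩, hf⟩
  rw [hu, hv, hn, h2]
  exact ⟨by simp; linarith, by simpa using hs⟩

theorem milnorNeg_nonempty (h : IsLefschetzChart OX OB f p φ ψ) {r : ℝ} (hr0 : 0 < r)
    (hr : ∀ v, ‖coordU v‖ ^ 2 + ‖coordV v‖ ^ 2 < r → v ∈ φ.target) :
    (milnorNeg φ r ∩ f ⁻¹' {f p}).Nonempty := by
  have hs : 0 < √(r / 2) := Real.sqrt_pos.2 (by linarith)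
  have h2 : √(r / 2) ^ 2 = r / 2 := Real.sq_sqrt (by linarith)
  have hn : ‖((√(r / 2) : ℝ) : ℂ)‖ = √(r / 2) := by
    rw [Complex.norm_real, Real.norm_of_nonneg hs.le]
  obtain ⟨x, hx, hu, hv, hf⟩ := h.exists_mem_fiber (q := (0, (√(r / 2) : ℝ))) (by simp)
    (hr _ (by rw [coordU_ofNull, coordV_ofNull, hn, h2]; simp; linarith))
  refine ⟨x, ⟨hx, ?_⟩, hf⟩
  rw [hu, hv, hn, h2]
  exact ⟨by simp; linarith, by simpa using hs⟩

theorem self_mem_milnorBall (h : IsLefschetzChart OX OB f p φ ψ) {r : ℝ} (hr0 : 0 < r) :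
    p ∈ milnorBall φ r := by
  refine ⟨h.mem_source, ?_⟩
  rw [sq_norm_coordU_add, h.map_zero]
  simpa using hr0

theorem exists_radius (h : IsLefschetzChart OX OB f p φ ψ) {O : Set X} (hO : O ∈ 𝓝 p) :
    ∃ r > 0, (∀ v, ‖coordU v‖ ^ 2 + ‖coordV v‖ ^ 2 < r → v ∈ φ.target) ∧
      milnorBall φ r ⊆ O := by
  have h0 : (0 : EuclideanSpace ℝ (Fin 4)) ∈ φ.target := h.map_zero ▸ φ.map_source h.mem_source
  have hs : φ.symm 0 = p := by rw [← h.map_zero, φ.left_inv h.mem_source]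
  have hn : φ.target ∩ φ.symm ⁻¹' O ∈ 𝓝 (0 : EuclideanSpace ℝ (Fin 4)) :=
    Filter.inter_mem (φ.open_target.mem_nhds h0)
      ((φ.continuousAt_symm h0).preimage_mem_nhds (hs.symm ▸ hO))
  obtain ⟨ε, hε, hball⟩ := Metric.mem_nhds_iff.1 hn
  -- The factor 2 comes from `‖u‖ ^ 2 + ‖v‖ ^ 2 = 2 ‖(z₁, z₂)‖ ^ 2`.
  have hmem : ∀ v, ‖coordU v‖ ^ 2 + ‖coordV v‖ ^ 2 < 2 * ε ^ 2 →
      v ∈ φ.target ∩ φ.symm ⁻¹' O := by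
    intro v hv
    refine hball (mem_ball_zero_iff.2 ?_)
    rw [sq_norm_coordU_add] at hv
    exact lt_of_pow_lt_pow_left₀ 2 hε.le (by linarith)
  refine ⟨2 * ε ^ 2, by positivity, fun v hv => (hmem v hv).1, fun x hx => ?_⟩
  have := (hmem _ hx.2).2
  rwa [mem_preimage, φ.left_inv hx.1] at this

/-- On the cycle `‖u‖ = ‖v‖` and `uv = t`, so `‖u‖ ^ 2 + ‖v‖ ^ 2 = 2 ‖t‖ ≤ r / 2`. Pieces avoiding
the core therefore avoid the cycle. -/
theorem vanishingCycle_subset_core (h : IsLefschetzChart OX OB f p φ ψ) {b : B} {r : ℝ}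
    (hb : ‖coordW (ψ b)‖ ≤ r / 4) : vanishingCycle f φ b ⊆ milnorCore φ r := by
  intro x hx
  obtain ⟨hs, rfl, hn⟩ := mem_vanishingCycle_iff.1 hx
  refine ⟨hs, ?_⟩
  rw [← h.mul_eq hs, norm_mul, hn] at hb
  rw [hn]
  linarith

/-- A vanishing cycle in a nearby fiber is a circle. -/
theorem nonempty_vanishingCycle_homeomorph [T2Space X] (h : IsLefschetzChart OX OB f p φ ψ)
    {b : B} {r : ℝ} (hbs : b ∈ ψ.source) (hne : b ≠ f p) (hb : ‖coordW (ψ b)‖ ≤ r / 4)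
    (hr0 : 0 < r) (hr : ∀ v, ‖coordU v‖ ^ 2 + ‖coordV v‖ ^ 2 < r → v ∈ φ.target) :
    Nonempty (vanishingCycle f φ b ≃ₜ Circle) := by
  set t := coordW (ψ b) with ht
  have ht0 : t ≠ 0 := h.coordW_ne_zero hbs hne
  have hρ : 0 < √‖t‖ := Real.sqrt_pos.2 (norm_pos_iff.2 ht0)
  have hρ2 : √‖t‖ ^ 2 = ‖t‖ := Real.sq_sqrt (norm_nonneg t)
  have hρ0 : ((√‖t‖ : ℝ) : ℂ) ≠ 0 := by exact_mod_cast hρ.ne'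
  -- The cycle is `uv = t`, `‖u‖ = ‖v‖ = √‖t‖`, parametrized by the argument of `u`.
  let q : Circle → ℂ × ℂ := fun z => ((√‖t‖ : ℝ) * z, t / ((√‖t‖ : ℝ) * z))
  have hz0 : ∀ z : Circle, ((√‖t‖ : ℝ) : ℂ) * z ≠ 0 := fun z => mul_ne_zero hρ0 z.coe_ne_zero
  have hn1 : ∀ z, ‖(q z).1‖ = √‖t‖ := by
    intro z
    rw [norm_mul, Complex.norm_real, Real.norm_of_nonneg hρ.le, Circle.norm_coe, mul_one]
  have hn2 : ∀ z, ‖(q z).2‖ = √‖t‖ := by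
    intro z
    change ‖t / (q z).1‖ = _
    rw [norm_div, hn1, div_eq_iff hρ.ne', ← sq, hρ2]
  have hqm : ∀ z, (q z).1 * (q z).2 = t := fun z => mul_div_cancel₀ _ (hz0 z)
  have hqt : ∀ z, ofNull (q z) ∈ φ.target := fun z => hr _ (by
    rw [coordU_ofNull, coordV_ofNull, hn1, hn2, hρ2]; linarith)
  have hqc : Continuous q := by
    have : Continuous fun z : Circle => ((√‖t‖ : ℝ) : ℂ) * z :=
      continuous_const.mul continuous_subtype_val
    exact this.prodMk (continuous_const.div this hz0)
  let γ : Circle → X := fun z => φ.symm (ofNull (q z))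
  have hγ : Continuous γ :=
    φ.continuousOn_symm.comp_continuous (continuous_ofNull.comp hqc) hqt
  have hγi : Function.Injective γ := by
    intro z w e
    have e₁ := φ.symm.injOn (hqt z) (hqt w) e
    have e₂ := congrArg coordU e₁
    rw [coordU_ofNull, coordU_ofNull] at e₂
    exact Circle.ext (mul_left_cancel₀ hρ0 e₂)
  have hrange : range γ = vanishingCycle f φ b := by
    ext x
    rw [mem_vanishingCycle_iff]
    constructor
    · rintro ⟨z, rfl⟩
      have hs := φ.map_target (hqt z)
      refine ⟨hs, (h.eq_iff hs hbs).2 ?_, ?_⟩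
      · rw [φ.right_inv (hqt z), coordU_ofNull, coordV_ofNull, hqm]
      · rw [φ.right_inv (hqt z), coordU_ofNull, coordV_ofNull, hn1, hn2]
    · rintro ⟨hs, hx, hn⟩
      have hm := (h.eq_iff hs hbs).1 hx
      rw [← ht] at hm
      have hU : ‖coordU (φ x)‖ = √‖t‖ := by
        rw [← hm, norm_mul, ← hn, Real.sqrt_mul_self (norm_nonneg _)]
      let z : Circle := ⟨coordU (φ x) / (√‖t‖ : ℝ), mem_sphere_zero_iff_norm.2 (by
        rw [norm_div, hU, Complex.norm_real, Real.norm_of_nonneg hρ.le, div_self hρ.ne'])⟩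
      have hz : ((√‖t‖ : ℝ) : ℂ) * z = coordU (φ x) := mul_div_cancel₀ _ hρ0
      have hU0 : coordU (φ x) ≠ 0 := hz ▸ hz0 z
      refine ⟨z, ?_⟩
      simp only [γ, q]
      rw [hz, ← hm, mul_div_cancel_left₀ _ hU0, ofNull_coord, φ.left_inv hs]
  have hemb := (hγ.isClosedEmbedding hγi).isEmbedding.toHomeomorph
  exact ⟨(hemb.trans (Homeomorph.setCongr hrange)).symm⟩

end IsLefschetzChart

end

/-! ### Disc slices at regular points -/

/-- A ball is homeomorphic to the whole space, where complements of countable sets are connected in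
dimension at least 2. -/
theorem isPreconnected_ball_diff {E : Type*} [NormedAddCommGroup E] [NormedSpace ℝ E]
    (hE : 1 < Module.rank ℝ E) {δ : ℝ} (hδ : 0 < δ) {s : Set E} (hs : s.Finite) :
    IsPreconnected (Metric.ball 0 δ \ s) := by
  let e := OpenPartialHomeomorph.univBall (0 : E) δ
  have hsrc : e.source = univ := OpenPartialHomeomorph.univBall_source 0 δ
  have htgt : e.target = Metric.ball 0 δ := OpenPartialHomeomorph.univBall_target 0 hδ
  have hinj : Function.Injective e := injOn_univ.1 (hsrc ▸ e.injOn)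
  have hfin : (e ⁻¹' s).Finite := hs.preimage hinj.injOn
  convert (hfin.countable.isConnected_compl_of_one_lt_rank hE).isPreconnected.image e
    (e.continuousOn.mono (hsrc ▸ subset_univ _)) using 1
  rw [← preimage_compl, image_preimage_eq_inter_range, ← image_univ, ← hsrc, e.image_source_eq_target,
    htgt, inter_comm, sdiff_eq]

/-- A submersion has product neighbourhoods, whose slices are discs. -/
theorem HasStrictFDerivAt.exists_connected_slices {E F : Type*} [NormedAddCommGroup E]
    [NormedSpace ℝ E] [FiniteDimensional ℝ E] [NormedAddCommGroup F] [NormedSpace ℝ F]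
    [FiniteDimensional ℝ F] (hdim : Module.finrank ℝ F + 1 < Module.finrank ℝ E)
    {g : E → F} {g' : E →L[ℝ] F} {a : E}
    (hg : HasStrictFDerivAt g g' a) (hs : Function.Surjective g') {O : Set E} (hO : O ∈ 𝓝 a) :
    ∃ V, IsOpen V ∧ a ∈ V ∧ V ⊆ O ∧ ∃ W ∈ 𝓝 (g a), ∀ y ∈ W,
      (∀ s : Set E, s.Finite → IsPreconnected ((V ∩ g ⁻¹' {y}) \ s)) ∧
      (V ∩ g ⁻¹' {y}).Infinite := by
  have := FiniteDimensional.complete ℝ E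
  have hrange : g'.range = ⊤ := LinearMap.range_eq_top.2 hs
  have hker : 1 < Module.rank ℝ g'.ker := by
    have h := LinearMap.finrank_range_add_finrank_ker (g' : E →ₗ[ℝ] F)
    rw [hrange, finrank_top] at h
    rw [← Module.finrank_eq_rank]
    have : 1 < Module.finrank ℝ g'.ker := by omega
    exact_mod_cast this
  have hnt : Nontrivial g'.ker := by
    rw [← rank_pos_iff_nontrivial (R := ℝ)]
    exact zero_lt_one.trans hker
  -- The implicit function theorem turns `g` into a projection with fiber `g'.ker`, whose dimension
  -- is at least 2 by `hdim`; the slices become balls in this kernel.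
  let e := hg.implicitToOpenPartialHomeomorph g g' hrange
  have hea : e a = (g a, 0) := hg.implicitToOpenPartialHomeomorph_self hrange
  have has : a ∈ e.source := hg.mem_implicitToOpenPartialHomeomorph_source hrange
  have hfst : ∀ x, (e x).1 = g x := hg.implicitToOpenPartialHomeomorph_fst hrange
  have hnhd : e.target ∩ e.symm ⁻¹' O ∈ 𝓝 (g a, (0 : g'.ker)) := by
    rw [← hea]
    refine Filter.inter_mem (e.open_target.mem_nhds (e.map_source has)) ?_
    refine (e.continuousAt_symm (e.map_source has)).preimage_mem_nhds ?_
    rwa [e.left_inv has]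
  rw [nhds_prod_eq, Filter.mem_prod_iff] at hnhd
  obtain ⟨W, hW, K, hK, hWK⟩ := hnhd
  obtain ⟨W', hW'W, hW', haW'⟩ := mem_nhds_iff.1 hW
  obtain ⟨δ, hδ, hball⟩ := Metric.mem_nhds_iff.1 hK
  have hprod : W' ×ˢ Metric.ball 0 δ ⊆ e.target ∩ e.symm ⁻¹' O :=
    (prod_mono hW'W hball).trans hWK
  refine ⟨e.source ∩ e ⁻¹' (W' ×ˢ Metric.ball 0 δ),
    e.isOpen_inter_preimage (hW'.prod Metric.isOpen_ball), ⟨has, ?_⟩, ?_, W', hW'.mem_nhds haW', ?_⟩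
  · rw [mem_preimage, hea]
    exact ⟨haW', Metric.mem_ball_self hδ⟩
  · rintro x ⟨hx, hx'⟩
    have := (hprod hx').2
    rwa [mem_preimage, e.left_inv hx] at this
  intro y hy
  have hmem : ∀ k ∈ Metric.ball (0 : g'.ker) δ, (y, k) ∈ e.target := fun k hk => (hprod ⟨hy, hk⟩).1
  let σ : g'.ker → E := fun k => e.symm (y, k)
  have hσc : ContinuousOn σ (Metric.ball 0 δ) :=
    e.continuousOn_symm.comp (by fun_prop) fun k hk => hmem k hk
  have hσi : InjOn σ (Metric.ball 0 δ) := fun k hk l hl h =>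
    (Prod.ext_iff.1 (e.symm.injOn (hmem k hk) (hmem l hl) h)).2
  have hslice : (e.source ∩ e ⁻¹' (W' ×ˢ Metric.ball 0 δ)) ∩ g ⁻¹' {y} =
      σ '' Metric.ball 0 δ := by
    ext x
    constructor
    · rintro ⟨⟨hx, hx'⟩, hxy⟩
      refine ⟨(e x).2, hx'.2, ?_⟩
      have : (y, (e x).2) = e x := Prod.ext (by rw [hfst]; exact (mem_singleton_iff.1 hxy).symm) rfl
      simp only [σ]
      rw [this, e.left_inv hx]
    · rintro ⟨k, hk, rfl⟩
      have h := e.right_inv (hmem k hk)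
      refine ⟨⟨e.map_target (hmem k hk), ?_⟩, ?_⟩
      · rw [mem_preimage, h]
        exact ⟨hy, hk⟩
      · rw [mem_preimage, ← hfst, h]
        rfl
  rw [hslice]
  refine ⟨fun s hsf => ?_, Infinite.image hσi (infinite_of_mem_nhds 0 (Metric.ball_mem_nhds 0 hδ))⟩
  have hfin : (Metric.ball 0 δ ∩ σ ⁻¹' s).Finite := by
    refine Finite.of_finite_image (hsf.subset ?_) (hσi.mono inter_subset_left)
    rintro _ ⟨k, hk, rfl⟩
    exact hk.2
  convert (isPreconnected_ball_diff hker hδ hfin).image σ (hσc.mono sdiff_subset) using 1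
  ext x
  constructor
  · rintro ⟨⟨k, hk, rfl⟩, hks⟩
    exact ⟨k, ⟨hk, fun h => hks h.2⟩, rfl⟩
  · rintro ⟨k, ⟨hk, hks⟩, rfl⟩
    exact ⟨⟨k, hk, rfl⟩, fun h => hks ⟨hk, h⟩⟩

section

theorem mdifferentiable_of_mem_maximalAtlas {n : ℕ} {M : Type*} [TopologicalSpace M]
    [ChartedSpace (EuclideanSpace ℝ (Fin n)) M]
    {φ : OpenPartialHomeomorph M (EuclideanSpace ℝ (Fin n))}
    (h : φ ∈ IsManifold.maximalAtlas (𝓡 n) ∞ M) : φ.MDifferentiable (𝓡 n) (𝓡 n) :=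
  ⟨(contMDiffOn_of_mem_maximalAtlas h).mdifferentiableOn (by simp),
    (contMDiffOn_symm_of_mem_maximalAtlas h).mdifferentiableOn (by simp)⟩

variable {X B : Type*}
  [TopologicalSpace X] [ChartedSpace (EuclideanSpace ℝ (Fin 4)) X]
  [TopologicalSpace B] [ChartedSpace (EuclideanSpace ℝ (Fin 2)) B]
  {f : X → B}
  {φ : OpenPartialHomeomorph X (EuclideanSpace ℝ (Fin 4))}
  {ψ : OpenPartialHomeomorph B (EuclideanSpace ℝ (Fin 2))}

theorem mfderiv_surjective_of_fderiv {x : X} (hφ : φ ∈ IsManifold.maximalAtlas (𝓡 4) ∞ X)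
    (hψ : ψ ∈ IsManifold.maximalAtlas (𝓡 2) ∞ B) (hx : x ∈ φ.source) (hfx : f x ∈ ψ.source)
    (hf : MDifferentiableAt (𝓡 4) (𝓡 2) f x)
    {Q : EuclideanSpace ℝ (Fin 4) → EuclideanSpace ℝ (Fin 2)}
    {Q' : EuclideanSpace ℝ (Fin 4) →L[ℝ] EuclideanSpace ℝ (Fin 2)}
    (hQ : HasFDerivAt Q Q' (φ x)) (hQ' : Function.Surjective Q')
    (heq : ψ ∘ f =ᶠ[𝓝 x] Q ∘ φ) : Function.Surjective (mfderiv (𝓡 4) (𝓡 2) f x) := by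
  have hφ' := mdifferentiable_of_mem_maximalAtlas hφ
  have hψ' := mdifferentiable_of_mem_maximalAtlas hψ
  have h₁ := (hψ'.mdifferentiableAt hfx).hasMFDerivAt.comp x hf.hasMFDerivAt
  have h₂ := (hQ.hasMFDerivAt.comp x (hφ'.mdifferentiableAt hx).hasMFDerivAt).congr_of_eventuallyEq
    heq
  have h := hasMFDerivAt_unique h₁ h₂
  intro w
  obtain ⟨v, hv⟩ := hQ' (mfderiv (𝓡 2) (𝓡 2) ψ (f x) w)
  obtain ⟨z, hz⟩ := hφ'.mfderiv_surjective hx v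
  refine ⟨z, hψ'.mfderiv_injective hfx ?_⟩
  have := DFunLike.congr_fun h z
  refine this.trans ?_
  rw [← hv, ← hz]
  rfl

theorem fderiv_surjective_of_mfderiv {x : X} (hφ : φ ∈ IsManifold.maximalAtlas (𝓡 4) ∞ X)
    (hψ : ψ ∈ IsManifold.maximalAtlas (𝓡 2) ∞ B) (hx : x ∈ φ.source) (hfx : f x ∈ ψ.source)
    (hf : MDifferentiableAt (𝓡 4) (𝓡 2) f x)
    (hs : Function.Surjective (mfderiv (𝓡 4) (𝓡 2) f x)) :
    Function.Surjective (fderiv ℝ (ψ ∘ f ∘ φ.symm) (φ x)) := by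
  have hφ' := mdifferentiable_of_mem_maximalAtlas hφ
  have hψ' := mdifferentiable_of_mem_maximalAtlas hψ
  have hl := φ.left_inv hx
  have h₁ : HasMFDerivAt (𝓡 4) (𝓡 2) f (φ.symm (φ x)) (mfderiv (𝓡 4) (𝓡 2) f x) :=
    hl.symm ▸ hf.hasMFDerivAt
  have h₂ : HasMFDerivAt (𝓡 2) (𝓡 2) ψ ((f ∘ φ.symm) (φ x)) (mfderiv (𝓡 2) (𝓡 2) ψ (f x)) := by
    rw [Function.comp_apply, hl]
    exact (hψ'.mdifferentiableAt hfx).hasMFDerivAt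
  have h₃ := (hφ'.mdifferentiableAt_symm (φ.map_source hx)).hasMFDerivAt
  have h := h₂.comp (φ x) (h₁.comp (φ x) h₃)
  rw [← mfderiv_eq_fderiv, h.mfderiv]
  exact (hψ'.mfderiv_surjective hfx).comp
    (hs.comp (hφ'.symm.mfderiv_surjective (φ.map_source hx)))

theorem contDiffAt_in_charts {x : X} (hφ : φ ∈ IsManifold.maximalAtlas (𝓡 4) ∞ X)
    (hψ : ψ ∈ IsManifold.maximalAtlas (𝓡 2) ∞ B) (hx : x ∈ φ.source) (hfx : f x ∈ ψ.source)
    (hf : ContMDiff (𝓡 4) (𝓡 2) ∞ f) : ContDiffAt ℝ ∞ (ψ ∘ f ∘ φ.symm) (φ x) := by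
  have hl := φ.left_inv hx
  rw [← contMDiffAt_iff_contDiffAt]
  have h₁ := contMDiffAt_symm_of_mem_maximalAtlas hφ (φ.map_source hx)
  have h₂ : ContMDiffAt (𝓡 2) (𝓡 2) ∞ ψ ((f ∘ φ.symm) (φ x)) := by
    rw [Function.comp_apply, hl]
    exact contMDiffAt_of_mem_maximalAtlas hψ hfx
  exact h₂.comp (φ x) ((hf _).comp (φ x) h₁)

/-- If `R'` is a right inverse of `A`, then `A' ∘ R'` is near the identity, hence invertible, for
`A'` near `A`. -/
theorem ContinuousLinearMap.eventually_surjective {E F : Type*} [NormedAddCommGroup E]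
    [NormedSpace ℝ E] [NormedAddCommGroup F] [NormedSpace ℝ F] [FiniteDimensional ℝ F]
    {A : E →L[ℝ] F} (hA : Function.Surjective A) :
    ∀ᶠ A' : E →L[ℝ] F in 𝓝 A, Function.Surjective A' := by
  have := FiniteDimensional.complete ℝ F
  obtain ⟨R, hR⟩ := (A : E →ₗ[ℝ] F).exists_rightInverse_of_surjective
    (LinearMap.range_eq_top.2 hA)
  let R' : F →L[ℝ] E := LinearMap.toContinuousLinearMap R
  have hcont : Continuous fun A' : E →L[ℝ] F => A'.comp R' := by fun_prop
  have h1 : A.comp R' = 1 := by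
    ext v
    exact LinearMap.congr_fun hR v
  have hunit : {T : F →L[ℝ] F | IsUnit T} ∈ 𝓝 (A.comp R') :=
    Units.isOpen.mem_nhds (h1 ▸ isUnit_one)
  filter_upwards [hcont.continuousAt.preimage_mem_nhds hunit] with A' hA' w
  obtain ⟨T, hT⟩ := hA'.exists_right_inv
  exact ⟨R' (T w), DFunLike.congr_fun hT w⟩

variable [IsManifold (𝓡 4) ∞ X] [IsManifold (𝓡 2) ∞ B]

theorem isOpen_compl_criticalPoints (hf : ContMDiff (𝓡 4) (𝓡 2) ∞ f) :
    IsOpen (criticalPoints f)ᶜ := by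
  rw [isOpen_iff_mem_nhds]
  intro x hx
  have hs : Function.Surjective (mfderiv (𝓡 4) (𝓡 2) f x) := not_not.1 hx
  let φ := chartAt (EuclideanSpace ℝ (Fin 4)) x
  let ψ := chartAt (EuclideanSpace ℝ (Fin 2)) (f x)
  have hφ : φ ∈ IsManifold.maximalAtlas (𝓡 4) ∞ X := IsManifold.chart_mem_maximalAtlas x
  have hψ : ψ ∈ IsManifold.maximalAtlas (𝓡 2) ∞ B := IsManifold.chart_mem_maximalAtlas (f x)
  have hx₀ : x ∈ φ.source := mem_chart_source _ x
  have hfx₀ : f x ∈ ψ.source := mem_chart_source _ (f x)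
  have hfm : ∀ y, MDifferentiableAt (𝓡 4) (𝓡 2) f y := hf.mdifferentiable (by simp)
  have hc := (contDiffAt_in_charts hφ hψ hx₀ hfx₀ hf).fderiv_right (m := 0) (by simp)
  have hev := hc.continuousAt.eventually (ContinuousLinearMap.eventually_surjective
    (fderiv_surjective_of_mfderiv hφ hψ hx₀ hfx₀ (hfm x) hs))
  have hev' := (φ.continuousAt hx₀).eventually hev
  filter_upwards [hev', φ.open_source.mem_nhds hx₀,
    hf.continuous.continuousAt.preimage_mem_nhds (ψ.open_source.mem_nhds hfx₀)] with y hy hyφ hyψ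
  refine not_not.2 (mfderiv_surjective_of_fderiv hφ hψ hyφ hyψ (hfm y)
    ((contDiffAt_in_charts hφ hψ hyφ hyψ hf).differentiableAt (by simp)).hasFDerivAt hy ?_)
  filter_upwards [φ.open_source.mem_nhds hyφ] with z hz
  simp [φ.left_inv hz]

/-- Near a regular point, the fibers of `f` are discs. -/
theorem exists_regular_piece (hf : ContMDiff (𝓡 4) (𝓡 2) ∞ f) {x : X}
    (hx : x ∉ criticalPoints f) {O : Set X} (hO : O ∈ 𝓝 x) :
    ∃ V, IsOpen V ∧ x ∈ V ∧ V ⊆ O ∧ ∃ W ∈ 𝓝 (f x), ∀ b ∈ W,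
      (∀ s : Set X, s.Finite → IsPreconnected ((V ∩ f ⁻¹' {b}) \ s)) ∧
      (V ∩ f ⁻¹' {b}).Infinite := by
  have hs : Function.Surjective (mfderiv (𝓡 4) (𝓡 2) f x) := not_not.1 hx
  let φ := chartAt (EuclideanSpace ℝ (Fin 4)) x
  let ψ := chartAt (EuclideanSpace ℝ (Fin 2)) (f x)
  have hφ : φ ∈ IsManifold.maximalAtlas (𝓡 4) ∞ X := IsManifold.chart_mem_maximalAtlas x
  have hψ : ψ ∈ IsManifold.maximalAtlas (𝓡 2) ∞ B := IsManifold.chart_mem_maximalAtlas (f x)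
  have hx₀ : x ∈ φ.source := mem_chart_source _ x
  have hfx₀ : f x ∈ ψ.source := mem_chart_source _ (f x)
  have hl := φ.left_inv hx₀
  have hsurj := fderiv_surjective_of_mfderiv hφ hψ hx₀ hfx₀ (hf.mdifferentiable (by simp) x) hs
  have hg := (contDiffAt_in_charts hφ hψ hx₀ hfx₀ hf).hasStrictFDerivAt (by simp)
  have hnhd : φ.target ∩ φ.symm ⁻¹' (O ∩ f ⁻¹' ψ.source) ∈ 𝓝 (φ x) := by
    refine Filter.inter_mem (φ.open_target.mem_nhds (φ.map_source hx₀)) ?_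
    refine (φ.continuousAt_symm (φ.map_source hx₀)).preimage_mem_nhds ?_
    rw [hl]
    exact Filter.inter_mem hO
      (hf.continuous.continuousAt.preimage_mem_nhds (ψ.open_source.mem_nhds hfx₀))
  obtain ⟨V, hV, hxV, hVO, W, hW, h⟩ := hg.exists_connected_slices (by simp) hsurj hnhd
  have hgx : (ψ ∘ f ∘ φ.symm) (φ x) = ψ (f x) := by simp [hl]
  rw [hgx] at hW
  refine ⟨φ.source ∩ φ ⁻¹' V, φ.isOpen_inter_preimage hV, ⟨hx₀, hxV⟩, ?_, ψ.source ∩ ψ ⁻¹' W,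
    Filter.inter_mem (ψ.open_source.mem_nhds hfx₀)
      ((ψ.continuousAt hfx₀).preimage_mem_nhds hW), ?_⟩
  · rintro y ⟨hy, hyV⟩
    have := (hVO hyV).2.1
    rwa [φ.left_inv hy] at this
  rintro b ⟨hb, hbW⟩
  obtain ⟨hpre, hinf⟩ := h (ψ b) hbW
  have hVt : V ⊆ φ.target := fun v hv => (hVO hv).1
  have hslice : (φ.source ∩ φ ⁻¹' V) ∩ f ⁻¹' {b} =
      φ.symm '' (V ∩ (ψ ∘ f ∘ φ.symm) ⁻¹' {ψ b}) := by
    ext y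
    constructor
    · rintro ⟨⟨hy, hyV⟩, hyb⟩
      refine ⟨φ y, ⟨hyV, ?_⟩, φ.left_inv hy⟩
      simp only [mem_preimage, Function.comp_apply, φ.left_inv hy, mem_singleton_iff]
      exact congrArg ψ hyb
    · rintro ⟨v, ⟨hv, hvb⟩, rfl⟩
      refine ⟨⟨φ.map_target (hVt hv), ?_⟩, ψ.injOn (hVO hv).2.2 hb hvb⟩
      rwa [mem_preimage, φ.right_inv (hVt hv)]
  have hinj : InjOn φ.symm (V ∩ (ψ ∘ f ∘ φ.symm) ⁻¹' {ψ b}) :=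
    φ.symm.injOn.mono (inter_subset_left.trans hVt)
  rw [hslice]
  refine ⟨fun s hsf => ?_, hinf.image hinj⟩
  convert (hpre (φ '' (s ∩ φ.source)) ((hsf.inter_of_left _).image φ)).image φ.symm
    (φ.continuousOn_symm.mono (sdiff_subset.trans (inter_subset_left.trans hVt))) using 1
  ext y
  constructor
  · rintro ⟨⟨v, hv, rfl⟩, hvs⟩
    refine ⟨v, ⟨hv, fun hvs' => hvs ?_⟩, rfl⟩
    obtain ⟨z, hz, rfl⟩ := hvs'
    rw [φ.left_inv hz.2]
    exact hz.1
  · rintro ⟨v, ⟨hv, hvs⟩, rfl⟩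
    exact ⟨⟨v, hv, rfl⟩, fun h => hvs ⟨_, ⟨h, φ.map_target (hVt hv.1)⟩, φ.right_inv (hVt hv.1)⟩⟩

end

/-! ### Infinite subsets of a circle, as opposed to discs -/

/-- An infinite subset of the circle is disconnected by a suitable finite set. -/
theorem Circle.exists_not_isPreconnected_diff {E : Set Circle} (hE : E.Infinite) :
    ∃ s : Set Circle, s.Finite ∧ ¬ IsPreconnected (E \ s) := by
  by_contra! hcon
  obtain ⟨p, hp⟩ := hE.nonempty
  -- An angular coordinate whose only discontinuity is at `p`. If no finite set disconnected `E`,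
  -- the image of `E \ {p}` would be an interval, still order connected after losing an interior
  -- point.
  let g : Circle → ℝ := fun z => Complex.arg (-((z / p : Circle) : ℂ))
  have hg : ∀ z ∈ E \ {p}, ContinuousAt g z := by
    intro z hz
    have hslit : -((z / p : Circle) : ℂ) ∈ Complex.slitPlane := by
      rw [Complex.mem_slitPlane_iff_not_le_zero, Complex.le_def, not_and_or]
      by_contra! h
      have him : ((z / p : Circle) : ℂ).im = 0 := by simpa using h.2
      have hn : ‖((z / p : Circle) : ℂ)‖ = 1 := Circle.norm_coe _
      have hre : 0 ≤ ((z / p : Circle) : ℂ).re := by simpa using h.1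
      have h1 : (z / p : Circle) = 1 := by
        apply Circle.ext
        have hx : ((z / p : Circle) : ℂ) = ((((z / p : Circle) : ℂ).re : ℝ) : ℂ) :=
          Complex.ext rfl (by simpa using him)
        rw [hx, Complex.norm_real, Real.norm_of_nonneg hre] at hn
        rw [hx, hn]
        simp
      exact hz.2 (div_eq_one.1 h1)
    have hc : Continuous fun z : Circle => -((z / p : Circle) : ℂ) :=
      (continuous_subtype_val.comp
        (continuous_id.div' (continuous_const (y := p)) : Continuous fun z : Circle => z / p)).neg
    exact ContinuousAt.comp (f := fun z : Circle => -((z / p : Circle) : ℂ))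
      (Complex.continuousAt_arg hslit) hc.continuousAt
  have hinj : Function.Injective g := by
    intro z w h
    have h' := Complex.ext_norm_arg (by rw [norm_neg, norm_neg, Circle.norm_coe, Circle.norm_coe]) h
    exact div_left_injective (Circle.ext (neg_injective h'))
  have hinf : (E \ {p}).Infinite := hE.sdiff (finite_singleton p)
  obtain ⟨a, ha, c, hc, hac⟩ := (hinf.image hinj.injOn).nontrivial.exists_lt
  have hpre : ∀ s : Set Circle, s.Finite → IsPreconnected (g '' ((E \ {p}) \ s)) := by
    intro s hs
    refine IsPreconnected.image ?_ g fun z hz => (hg z hz.1).continuousWithinAt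
    rw [Set.sdiff_sdiff]
    exact hcon _ ((finite_singleton p).union hs)
  have h0 : OrdConnected (g '' (E \ {p})) := by simpa using (hpre ∅ finite_empty).ordConnected
  obtain ⟨z, hz, hzm⟩ := h0.out ha hc (⟨by linarith, by linarith⟩ : (a + c) / 2 ∈ Icc a c)
  have h1 := (hpre {z} (finite_singleton z)).ordConnected
  have hmem : ∀ y ∈ g '' (E \ {p}), y ≠ g z → y ∈ g '' ((E \ {p}) \ {z}) := by
    rintro _ ⟨w, hw, rfl⟩ hne
    exact ⟨w, ⟨hw, fun e => hne (congrArg g e)⟩, rfl⟩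
  obtain ⟨w, hw, hwz⟩ := h1.out (hmem a ha (by rw [hzm]; linarith))
    (hmem c hc (by rw [hzm]; linarith)) (⟨by linarith, by linarith⟩ : (a + c) / 2 ∈ Icc a c)
  exact hw.2 (hinj (hwz.trans hzm.symm))

theorem exists_not_isPreconnected_diff_of_homeomorph_circle {X : Type*} [TopologicalSpace X]
    {c D : Set X} (e : c ≃ₜ Circle) (hD : D ⊆ c) (hinf : D.Infinite) :
    ∃ s : Set X, s.Finite ∧ ¬ IsPreconnected (D \ s) := by
  have hEi : (e '' (Subtype.val ⁻¹' D)).Infinite := by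
    refine Infinite.image e.injective.injOn (Infinite.preimage hinf ?_)
    simpa using hD
  obtain ⟨s, hs, hns⟩ := Circle.exists_not_isPreconnected_diff hEi
  refine ⟨(fun z => (e.symm z : X)) '' s, hs.image _, fun h => hns ?_⟩
  have hsub : IsPreconnected (Subtype.val ⁻¹' (D \ (fun z => (e.symm z : X)) '' s) : Set c) := by
    rw [← IsInducing.subtypeVal.isPreconnected_image, Subtype.image_preimage_coe,
      inter_eq_right.2 (sdiff_subset.trans hD)]
    exact h
  convert hsub.image e e.continuous.continuousOn using 1
  ext z
  constructor
  · rintro ⟨⟨x, hx, rfl⟩, hxs⟩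
    refine ⟨x, ⟨hx, ?_⟩, rfl⟩
    rintro ⟨w, hw, hwx⟩
    rw [← Subtype.ext hwx, e.apply_symm_apply] at hxs
    exact hxs hw
  · rintro ⟨x, ⟨hx, hxs⟩, rfl⟩
    exact ⟨⟨x, hx, rfl⟩, fun h => hxs ⟨e x, h, by simp⟩⟩

/-! ### Isolated critical points and connected smooth fibers -/

section

theorem neBot_nhdsNE_of_chartedSpace {B : Type*} [TopologicalSpace B]
    [ChartedSpace (EuclideanSpace ℝ (Fin 2)) B] (b : B) : (𝓝[≠] b).NeBot := by
  refine ⟨fun h => ?_⟩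
  rw [← isOpen_singleton_iff_punctured_nhds] at h
  have := (chartAt (EuclideanSpace ℝ (Fin 2)) b).isOpen_image_of_subset_source h
    (singleton_subset_iff.2 (mem_chart_source _ b))
  rw [image_singleton] at this
  exact not_isOpen_singleton _ this

variable {X B : Type*}
  [TopologicalSpace X] [ChartedSpace (EuclideanSpace ℝ (Fin 4)) X]
  [TopologicalSpace B] [ChartedSpace (EuclideanSpace ℝ (Fin 2)) B] {f : X → B}

/-- The derivative of `z₁² + z₂²` is `2 z₁ dz₁ + 2 z₂ dz₂`, which is onto `ℂ` except at the origin.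
-/
theorem IsLefschetzChart.eq_of_mem_criticalPoints {OX : SmoothOrientation 4 X}
    {OB : SmoothOrientation 2 B} {p : X}
    {φ : OpenPartialHomeomorph X (EuclideanSpace ℝ (Fin 4))}
    {ψ : OpenPartialHomeomorph B (EuclideanSpace ℝ (Fin 2))}
    (h : IsLefschetzChart OX OB f p φ ψ) (hf : ContMDiff (𝓡 4) (𝓡 2) ∞ f)
    {x : X} (hx : x ∈ φ.source) (hxc : x ∈ criticalPoints f) : x = p := by
  by_contra hne
  refine hxc ?_
  have hv0 : φ x ≠ 0 := fun e => hne (φ.injOn hx h.mem_source (e.trans h.map_zero.symm))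
  let Z₁ : EuclideanSpace ℝ (Fin 4) →L[ℝ] ℂ := Complex.equivRealProdCLM.symm.toContinuousLinearMap ∘L
    ((EuclideanSpace.proj 0).prod (EuclideanSpace.proj 1))
  let Z₂ : EuclideanSpace ℝ (Fin 4) →L[ℝ] ℂ := Complex.equivRealProdCLM.symm.toContinuousLinearMap ∘L
    ((EuclideanSpace.proj 2).prod (EuclideanSpace.proj 3))
  have hZ₁ : ∀ v, Z₁ v = coordZ₁ v := fun v => by
    simp [Z₁, coordZ₁, Complex.ext_iff]
  have hZ₂ : ∀ v, Z₂ v = coordZ₂ v := fun v => by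
    simp [Z₂, coordZ₂, Complex.ext_iff]
  let L : ℂ ≃L[ℝ] EuclideanSpace ℝ (Fin 2) :=
    Complex.orthonormalBasisOneI.repr.toContinuousLinearEquiv
  have hL : ∀ w, coordW (L w) = w := fun w => by
    simp [L, coordW]
  have hd : HasFDerivAt (fun v => Z₁ v * Z₁ v + Z₂ v * Z₂ v)
      ((Z₁ (φ x) • Z₁ + Z₁ (φ x) • Z₁) + (Z₂ (φ x) • Z₂ + Z₂ (φ x) • Z₂)) (φ x) :=
    (Z₁.hasFDerivAt.mul Z₁.hasFDerivAt).add (Z₂.hasFDerivAt.mul Z₂.hasFDerivAt)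
  have hsurj : ∀ w : ℂ, ∃ v : EuclideanSpace ℝ (Fin 4),
      Z₁ (φ x) * Z₁ v + Z₁ (φ x) * Z₁ v + (Z₂ (φ x) * Z₂ v + Z₂ (φ x) * Z₂ v) = w := by
    intro w
    have hpt : ∀ a b : ℂ, ∃ v, Z₁ v = a ∧ Z₂ v = b := fun a b =>
      ⟨!₂[a.re, a.im, b.re, b.im], by simp [hZ₁, coordZ₁], by simp [hZ₂, coordZ₂]⟩
    by_cases h1 : Z₁ (φ x) = 0
    · have h2 : Z₂ (φ x) ≠ 0 := by
        intro h2
        refine hv0 (norm_eq_zero.1 (pow_eq_zero_iff two_ne_zero |>.1 ?_))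
        rw [← sq_norm_coordZ, ← hZ₁, ← hZ₂, h1, h2]
        simp
      obtain ⟨v, hv1, hv2⟩ := hpt 0 (w / (2 * Z₂ (φ x)))
      refine ⟨v, ?_⟩
      rw [hv1, hv2]
      field_simp
      ring
    · obtain ⟨v, hv1, hv2⟩ := hpt (w / (2 * Z₁ (φ x))) 0
      refine ⟨v, ?_⟩
      rw [hv1, hv2]
      field_simp
      ring
  refine mfderiv_surjective_of_fderiv h.positive_source.1 h.positive_target.1 hx (h.mapsTo hx)
    (hf.mdifferentiable (by simp) x) (L.hasFDerivAt.comp (φ x) hd) ?_ ?_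
  · refine L.surjective.comp fun w => ?_
    obtain ⟨v, hv⟩ := hsurj w
    exact ⟨v, hv⟩
  · filter_upwards [φ.open_source.mem_nhds hx] with y hy
    apply coordW_injective
    simp only [Function.comp_apply]
    rw [hL, h.eq y hy, hZ₁, hZ₂]
    ring

variable [IsManifold (𝓡 4) ∞ X] [IsManifold (𝓡 2) ∞ B]

/-- Curves have empty interior in a smooth fiber, so a fiber whose complement of finitely many
disjoint curves is connected is itself connected. -/
theorem isPreconnected_fiber_of_hasGenus [T2Space X] (hf : ContMDiff (𝓡 4) (𝓡 2) ∞ f) {b : B}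
    (hb : b ∉ criticalValues f) {h : ℕ} (hS : HasGenus (f ⁻¹' {b}) h) :
    IsPreconnected (f ⁻¹' {b}) := by
  obtain ⟨c, -, hhomeo, hdisj, hconn⟩ := hS.1
  refine hconn.isPreconnected.subset_closure sdiff_subset fun x hx => ?_
  by_contra hxc
  rw [mem_closure_iff] at hxc
  push Not at hxc
  obtain ⟨O, hO, hxO, hOe⟩ := hxc
  have hsub : ∀ y ∈ O, f y = b → ∃ i, y ∈ c i := by
    intro y hy hyb
    by_contra! hcon
    exact (hOe ▸ ⟨hy, hyb, by simpa using hcon⟩ : y ∈ (∅ : Set X))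
  obtain ⟨i, hi⟩ := hsub x hxO hx
  have hclosed : ∀ j, IsClosed (c j) := by
    intro j
    obtain ⟨e⟩ := hhomeo j
    have : CompactSpace (c j) := e.symm.compactSpace
    exact (isCompact_iff_compactSpace.2 this).isClosed
  -- Away from the other curves, a small disc slice of the fiber would lie in the single circle `c
  -- i`. A finite set would then disconnect it, which is impossible for a disc.
  have hN : O ∩ ⋂ j ∈ {j | j ≠ i}, (c j)ᶜ ∈ 𝓝 x := by
    refine Filter.inter_mem (hO.mem_nhds hxO) ((Filter.biInter_mem (toFinite _)).2 fun j hj => ?_)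
    exact (hclosed j).isOpen_compl.mem_nhds fun hxj => (hdisj i j (Ne.symm hj)).le_bot ⟨hi, hxj⟩
  have hxr : x ∉ criticalPoints f := fun hxc => hb ⟨x, hxc, hx⟩
  obtain ⟨V, -, -, hVN, W, hW, hVW⟩ := exists_regular_piece hf hxr hN
  obtain ⟨hpre, hinf⟩ := hVW (f x) (mem_of_mem_nhds hW)
  obtain ⟨e⟩ := hhomeo i
  obtain ⟨s, hs, hns⟩ := exists_not_isPreconnected_diff_of_homeomorph_circle
    (D := V ∩ f ⁻¹' {f x}) e (by
      rintro y ⟨hyV, hyx⟩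
      obtain ⟨j, hj⟩ := hsub y (hVN hyV).1 (hyx.trans hx)
      by_cases hji : j = i
      · exact hji ▸ hj
      · exact absurd hj (mem_iInter₂.1 (hVN hyV).2 j hji)) hinf
  exact hns (hpre s hs)

/-- The critical set is closed in a compact space, and each of its points is isolated by a Lefschetz
chart. -/
theorem IsLefschetzFibration.finite_criticalPoints [CompactSpace X] {OX : SmoothOrientation 4 X}
    {OB : SmoothOrientation 2 B} (hf : IsLefschetzFibration OX OB f) :
    (criticalPoints f).Finite := by
  by_contra hinf
  obtain ⟨x, hx, hacc⟩ := Infinite.exists_accPt_of_subset_isCompact hinf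
    (isOpen_compl_iff.1 (isOpen_compl_criticalPoints hf.smooth)).isCompact Subset.rfl
  obtain ⟨φ, ψ, h⟩ := hf.local_form x hx
  rw [accPt_iff_nhds] at hacc
  obtain ⟨y, hy, hne⟩ := hacc _ (φ.open_source.mem_nhds h.mem_source)
  exact hne (h.eq_of_mem_criticalPoints hf.smooth hy.1 hy.2)

end

/-! ### Comparing a singular fiber with nearby smooth fibers -/

section

universe u v

variable {X : Type u} {B : Type v}
  [TopologicalSpace X] [T2Space X] [CompactSpace X]
  [ChartedSpace (EuclideanSpace ℝ (Fin 4)) X] [IsManifold (𝓡 4) ∞ X]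
  [TopologicalSpace B] [T2Space B]
  [ChartedSpace (EuclideanSpace ℝ (Fin 2)) B] [IsManifold (𝓡 2) ∞ B]
  {OX : SmoothOrientation 4 X} {OB : SmoothOrientation 2 B} {f : X → B}

/-- Every singular fiber is compared with the nearby fibers by one finite family of pieces. -/
theorem exists_fiberComparison (hf : IsLefschetzFibration OX OB f) {b₀ : B}
    (hb₀ : b₀ ∈ criticalValues f)
    (φ : {p // p ∈ criticalPoints f ∧ f p = b₀} →
      OpenPartialHomeomorph X (EuclideanSpace ℝ (Fin 4)))
    (ψ : {p // p ∈ criticalPoints f ∧ f p = b₀} →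
      OpenPartialHomeomorph B (EuclideanSpace ℝ (Fin 2)))
    (hL : ∀ p, IsLefschetzChart OX OB f p.1 (φ p) (ψ p)) :
    ∃ (ι : Type u) (_ : Finite ι) (_ : Nonempty ι) (V : ι → Set X)
      (A : {p // p ∈ criticalPoints f ∧ f p = b₀} → Set X)
      (pos neg : {p // p ∈ criticalPoints f ∧ f p = b₀} → ι),
      ∀ᶠ b in 𝓝[≠] b₀,
        FiberComparison (f ⁻¹' {b₀} \ criticalPoints f) (f ⁻¹' {b}) V
          (fun p => vanishingCycle f (φ p) b) A pos neg ∧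
        (∀ p, Nonempty (vanishingCycle f (φ p) b ≃ₜ Circle)) ∧
        ∀ p q, p ≠ q → Disjoint (vanishingCycle f (φ p) b) (vanishingCycle f (φ q) b) := by
  classical
  let κ := {p // p ∈ criticalPoints f ∧ f p = b₀}
  have hfin := hf.finite_criticalPoints
  have : Finite κ := (hfin.subset fun p hp => hp.1 : {p | p ∈ criticalPoints f ∧ f p = b₀}.Finite)
  obtain ⟨U, hU, hUd⟩ := hfin.t2_separation
  choose r hr0 hrt hrU using fun p : κ => (hL p).exists_radius ((hU p).2.mem_nhds (hU p).1)
  have hdisj : ∀ p q : κ, p ≠ q → Disjoint (milnorBall (φ p) (r p)) (milnorBall (φ q) (r q)) :=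
    fun p q hpq => (hUd p.2.1 q.2.1 fun e => hpq (Subtype.ext e)).mono (hrU p) (hrU q)
  have hcore : ∀ p, milnorCore (φ p) (r p) ⊆ milnorBall (φ p) (r p) := fun p x hx =>
    ⟨hx.1, lt_of_le_of_lt hx.2 (by linarith [hr0 p])⟩
  have hself : ∀ p : κ, (p : X) ∈ milnorBall (φ p) (r p) := fun p =>
    (hL p).self_mem_milnorBall (hr0 p)
  have hzero : ∀ p : κ, ∀ x, x ∈ criticalPoints f → f x = b₀ → x ∈ milnorBall (φ p) (r p) →
      x = p := by
    intro p x hx hxb hxm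
    by_contra hne
    exact (hdisj ⟨x, hx, hxb⟩ p fun e => hne (congrArg Subtype.val e)).le_bot
      ⟨hself ⟨x, hx, hxb⟩, hxm⟩
  have hUV : ∀ p : κ, coordU (φ p p) = 0 ∧ coordV (φ p p) = 0 := by
    intro p
    rw [(hL p).map_zero]
    simp [coordU, coordV, coordZ₁, coordZ₂, Complex.ext_iff]
  have hne₁ : ∀ p x, x ∈ milnorPos (φ p) (r p) → f x = b₀ → x ∉ criticalPoints f := by
    intro p x hx hxb hxc
    have h := hx.2.2
    rw [hzero p x hxc hxb (milnorPos_subset hx), (hUV p).1, (hUV p).2] at h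
    exact lt_irrefl _ h
  have hne₂ : ∀ p x, x ∈ milnorNeg (φ p) (r p) → f x = b₀ → x ∉ criticalPoints f := by
    intro p x hx hxb hxc
    have h := hx.2.2
    rw [hzero p x hxc hxb (milnorNeg_subset hx), (hUV p).1, (hUV p).2] at h
    exact lt_irrefl _ h
  -- The compact part of the singular fiber outside the balls is covered by finitely many regular
  -- pieces. They may enter the balls but avoid the cores, where the vanishing cycles lie.
  set K : Set X := f ⁻¹' {b₀} \ ⋃ p, milnorBall (φ p) (r p) with hK
  have hKc : IsCompact K :=
    ((isClosed_singleton.preimage hf.smooth.continuous).sdiff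
      (isOpen_iUnion fun p => isOpen_milnorBall)).isCompact
  have hKcrit : ∀ x ∈ K, x ∉ criticalPoints f := fun x hx hxc =>
    hx.2 (mem_iUnion.2 ⟨⟨x, hxc, hx.1⟩, hself ⟨x, hxc, hx.1⟩⟩)
  have hKO : ∀ x : K, (criticalPoints f)ᶜ ∩ ⋂ p, (milnorCore (φ p) (r p))ᶜ ∈ 𝓝 (x : X) := by
    intro x
    refine Filter.inter_mem ((isOpen_compl_criticalPoints hf.smooth).mem_nhds (hKcrit x x.2))
      (Filter.iInter_mem.2 fun p => (isClosed_milnorCore (hr0 p) (hrt p)).isOpen_compl.mem_nhds ?_)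
    exact fun hx => x.2.2 (mem_iUnion.2 ⟨p, hcore p hx⟩)
  choose R hRo hxR hRO W hW hRW using fun x : K =>
    exists_regular_piece hf.smooth (hKcrit x x.2) (hKO x)
  obtain ⟨t, ht⟩ := hKc.elim_finite_subcover R hRo fun x hx => mem_iUnion.2 ⟨⟨x, hx⟩, hxR ⟨x, hx⟩⟩
  obtain ⟨p₀, hp₀, hp₀b⟩ := hb₀
  let V : κ ⊕ κ ⊕ t → Set X := Sum.elim (fun p => milnorPos (φ p) (r p))
    (Sum.elim (fun p => milnorNeg (φ p) (r p)) fun x => R x)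
  have hVo : ∀ i, IsOpen (V i) := by
    rintro (p | p | x)
    exacts [isOpen_milnorPos, isOpen_milnorNeg, hRo x]
  have hVcrit : ∀ i, ∀ x ∈ V i, f x = b₀ → x ∉ criticalPoints f := by
    rintro (p | p | y) x hx hxb
    exacts [hne₁ p x hx hxb, hne₂ p x hx hxb, (hRO y hx).1]
  have hG : IsOpen ((⋃ p, milnorBall (φ p) (r p)) ∪ ⋃ x ∈ t, R x) :=
    (isOpen_iUnion fun p => isOpen_milnorBall).union (isOpen_biUnion fun x _ => hRo x)
  have hev₁ : ∀ᶠ b in 𝓝 b₀, f ⁻¹' {b} ⊆ (⋃ p, milnorBall (φ p) (r p)) ∪ ⋃ x ∈ t, R x := by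
    -- Properness of `f`: a neighborhood of one fiber contains all nearby fibers.
    have hc : IsClosed (f '' ((⋃ p, milnorBall (φ p) (r p)) ∪ ⋃ x ∈ t, R x)ᶜ) :=
      (hG.isClosed_compl.isCompact.image hf.smooth.continuous).isClosed
    filter_upwards [hc.isOpen_compl.mem_nhds (x := b₀) (by
      rintro ⟨x, hx, hxb⟩
      refine hx ?_
      by_cases hxm : x ∈ ⋃ p, milnorBall (φ p) (r p)
      · exact Or.inl hxm
      · exact Or.inr (ht ⟨hxb, hxm⟩))] with b hb x hx
    by_contra hxn
    exact hb ⟨x, hxn, hx⟩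
  have hev₂ : ∀ᶠ b in 𝓝 b₀, ∀ p, b ∈ (ψ p).source ∧ ‖coordW (ψ p b)‖ ≤ r p / 4 := by
    refine Filter.eventually_all.2 fun p => ?_
    have hs : b₀ ∈ (ψ p).source := p.2.2 ▸ (hL p).apply_mem_source
    have hz : coordW (ψ p b₀) = 0 := by
      have h := (hL p).map_zero'
      rw [p.2.2] at h
      rw [h, coordW_zero]
    refine Filter.Eventually.and ((ψ p).open_source.mem_nhds hs) ?_
    have hc : ContinuousAt (fun b => ‖coordW (ψ p b)‖) b₀ :=
      (continuous_coordW.continuousAt.comp ((ψ p).continuousAt hs)).norm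
    refine (hc.eventually_lt continuousAt_const ?_).mono fun b hb => hb.le
    rw [hz, norm_zero]
    linarith [hr0 p]
  have hev₃ : ∀ᶠ b in 𝓝 b₀, ∀ x : t, b ∈ W x :=
    Filter.eventually_all.2 fun x => by
      have h := hW x
      rwa [(x : K).2.1] at h
  have hev₄ : ∀ᶠ b in 𝓝 b₀, ∀ i j, (V i ∩ V j ∩ (f ⁻¹' {b₀} \ criticalPoints f)).Nonempty →
      (V i ∩ V j ∩ f ⁻¹' {b}).Nonempty := by
    refine Filter.eventually_all.2 fun i => Filter.eventually_all.2 fun j => ?_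
    by_cases h : (V i ∩ V j ∩ (f ⁻¹' {b₀} \ criticalPoints f)).Nonempty
    -- A regular point in an overlap has a product neighborhood inside the overlap, which every
    -- nearby fiber meets.
    · obtain ⟨x, hx, hxb, hxc⟩ := h
      obtain ⟨V', -, -, hV', W', hW', h'⟩ := exists_regular_piece hf.smooth hxc
        (((hVo i).inter (hVo j)).mem_nhds hx)
      rw [hxb] at hW'
      filter_upwards [hW'] with b hb _
      exact (h' b hb).2.nonempty.mono (inter_subset_inter_left _ hV')
    · exact Filter.Eventually.of_forall fun b hb => absurd hb h
  have hinterF : ∀ i, V i ∩ (f ⁻¹' {b₀} \ criticalPoints f) = V i ∩ f ⁻¹' {b₀} := fun i =>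
    Subset.antisymm (inter_subset_inter_right _ sdiff_subset)
      fun x hx => ⟨hx.1, hx.2, hVcrit i x hx.1 hx.2⟩
  refine ⟨κ ⊕ κ ⊕ t, inferInstance, ⟨Sum.inl ⟨p₀, hp₀, hp₀b⟩⟩, V,
    fun p => milnorBall (φ p) (r p), fun p => Sum.inl p, fun p => Sum.inr (Sum.inl p), ?_⟩
  filter_upwards [self_mem_nhdsWithin, nhdsWithin_le_nhds hev₁, nhdsWithin_le_nhds hev₂,
    nhdsWithin_le_nhds hev₃, nhdsWithin_le_nhds hev₄] with b hne h₁ h₂ h₃ h₄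
  have hcyc : ∀ p, vanishingCycle f (φ p) b ⊆ milnorCore (φ p) (r p) := fun p =>
    (hL p).vanishingCycle_subset_core (h₂ p).2
  have hcycb : ∀ p, vanishingCycle f (φ p) b ⊆ milnorBall (φ p) (r p) := fun p =>
    (hcyc p).trans (hcore p)
  have hbne : ∀ p : κ, b ≠ f p := fun p e => hne (e.trans p.2.2)
  have hsplit : ∀ p x, x ∈ milnorBall (φ p) (r p) → f x = b →
      x ∈ milnorPos (φ p) (r p) ∪ vanishingCycle f (φ p) b ∪ milnorNeg (φ p) (r p) := by
    intro p x hx hxb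
    rcases lt_trichotomy ‖coordU (φ p x)‖ ‖coordV (φ p x)‖ with h | h | h
    · exact Or.inr ⟨hx.1, hx.2, h⟩
    · exact Or.inl (Or.inr (mem_vanishingCycle_iff.2 ⟨hx.1, hxb, h⟩))
    · exact Or.inl (Or.inl ⟨hx.1, hx.2, h⟩)
  refine ⟨?_, fun p => (hL p).nonempty_vanishingCycle_homeomorph (h₂ p).1 (hbne p) (h₂ p).2
    (hr0 p) (hrt p), fun p q hpq => (hdisj p q hpq).mono (hcycb p) (hcycb q)⟩
  constructor
  case isOpen_piece => exact hVo
  case piece_inter_singular =>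
    intro i
    rw [hinterF]
    have hs : ∀ p : κ, b₀ ∈ (ψ p).source := fun p => p.2.2 ▸ (hL p).apply_mem_source
    rcases i with p | p | x
    · exact (hL p).isPreconnected_milnorPos (hs p) (hrt p)
    · exact (hL p).isPreconnected_milnorNeg (hs p) (hrt p)
    · have h := (hRW x (f x) (mem_of_mem_nhds (hW x))).1 ∅ finite_empty
      rw [(x : K).2.1, sdiff_empty] at h
      exact h
  case piece_nonempty =>
    intro i
    rw [hinterF]
    rcases i with p | p | x
    · have h := (hL p).milnorPos_nonempty (hr0 p) (hrt p)
      rwa [p.2.2] at h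
    · have h := (hL p).milnorNeg_nonempty (hr0 p) (hrt p)
      rwa [p.2.2] at h
    · exact ⟨x, hxR x, (x : K).2.1⟩
  case cover_singular =>
    rintro x ⟨hxb, hxc⟩
    by_cases hxm : x ∈ ⋃ p, milnorBall (φ p) (r p)
    · obtain ⟨p, hp⟩ := mem_iUnion.1 hxm
      rcases lt_trichotomy ‖coordU (φ p x)‖ ‖coordV (φ p x)‖ with h | h | h
      · exact mem_iUnion.2 ⟨Sum.inr (Sum.inl p), hp.1, hp.2, h⟩
      -- On the singular fiber `uv = 0`, so `‖u‖ = ‖v‖` only at the critical point, which is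
      -- excluded.
      · have hm := (hL p).mul_eq hp.1
        have h0 := (hL p).map_zero'
        rw [p.2.2] at h0
        rw [show f x = b₀ from hxb, h0, coordW_zero] at hm
        have hn := congrArg norm hm
        rw [norm_mul, h, norm_zero, mul_self_eq_zero] at hn
        have hv := sq_norm_coordU_add (φ p x)
        rw [h, hn] at hv
        have hv0 : φ p x = 0 := norm_eq_zero.1 (pow_eq_zero_iff two_ne_zero |>.1 (by linarith))
        have hxp : x = p := (φ p).injOn hp.1 (hL p).mem_source (hv0.trans (hL p).map_zero.symm)
        exact absurd (hxp ▸ p.2.1) hxc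
      · exact mem_iUnion.2 ⟨Sum.inl p, hp.1, hp.2, h⟩
    · obtain ⟨y, hy, hxy⟩ := mem_iUnion₂.1 (ht ⟨hxb, hxm⟩)
      exact mem_iUnion.2 ⟨Sum.inr (Sum.inr ⟨y, hy⟩), hxy⟩
  case piece_inter =>
    rintro (p | p | x)
    · exact (hL p).isPreconnected_milnorPos (h₂ p).1 (hrt p)
    · exact (hL p).isPreconnected_milnorNeg (h₂ p).1 (hrt p)
    · have h := (hRW x b (h₃ x)).1 ∅ finite_empty
      rwa [sdiff_empty] at h
  case overlap => exact h₄
  case circle_subset => exact fun p x hx => hx.2.1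
  case disjoint_piece =>
    intro i q
    rw [Set.disjoint_left]
    intro x hx hxq
    have hn := (mem_vanishingCycle_iff.1 hxq).2.2
    rcases i with p | p | y
    · by_cases hpq : p = q
      · subst hpq
        exact hx.2.2.ne' hn
      · exact (hdisj p q hpq).le_bot ⟨milnorPos_subset hx, hcycb q hxq⟩
    · by_cases hpq : p = q
      · subst hpq
        exact hx.2.2.ne hn
      · exact (hdisj p q hpq).le_bot ⟨milnorNeg_subset hx, hcycb q hxq⟩
    · exact mem_iInter.1 (hRO y hx).2 q (hcyc q hxq)
  case cover =>
    intro x hx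
    rcases h₁ hx with h | h
    · obtain ⟨p, hp⟩ := mem_iUnion.1 h
      rcases hsplit p x hp hx with (h | h) | h
      · exact Or.inl (mem_iUnion.2 ⟨Sum.inl p, h⟩)
      · exact Or.inr (mem_iUnion.2 ⟨p, h⟩)
      · exact Or.inl (mem_iUnion.2 ⟨Sum.inr (Sum.inl p), h⟩)
    · obtain ⟨y, hy, hxy⟩ := mem_iUnion₂.1 h
      exact Or.inl (mem_iUnion.2 ⟨Sum.inr (Sum.inr ⟨y, hy⟩), hxy⟩)
  case isOpen_collar => exact fun p => isOpen_milnorBall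
  case circle_subset_collar => exact hcycb
  case collar_inter =>
    exact fun p => (hL p).isPreconnected_milnorBall (h₂ p).1 (hbne p) (hrt p)
  case collar_disjoint => exact fun p q hpq => (hdisj p q hpq).mono_right (hcycb q)
  case collar_subset => exact fun p x hx => hsplit p x hx.1 hx.2
  case pos_subset => exact fun p => milnorPos_subset
  case neg_subset => exact fun p => milnorNeg_subset

theorem HasGenus.card_le {X κ : Type*} [TopologicalSpace X] {S : Set X} {h : ℕ}
    (hS : HasGenus S h) {c : κ → Set X} (K : Finset κ) (hc : ∀ p, c p ⊆ S)
    (hhomeo : ∀ p, Nonempty (c p ≃ₜ Circle)) (hdisj : ∀ p q, p ≠ q → Disjoint (c p) (c q))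
    (hK : IsConnected (S \ ⋃ q ∈ (K : Set κ), c q)) : K.card ≤ h := by
  refine hS.2 ⟨fun i => c (K.equivFin.symm i), fun i => hc _, fun i => hhomeo _,
    fun i j hij => hdisj _ _ fun e => hij (K.equivFin.symm.injective (Subtype.ext e)), ?_⟩
  convert hK using 2
  ext x
  simp only [mem_iUnion]
  constructor
  · rintro ⟨i, hi⟩
    exact ⟨_, (K.equivFin.symm i).2, hi⟩
  · rintro ⟨q, hq, hx⟩
    exact ⟨K.equivFin ⟨q, hq⟩, by simpa using hx⟩

/-- The two inequalities for a single singular fiber. -/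
theorem componentClosures_bounds (hf : IsLefschetzFibration OX OB f) {h : ℕ}
    (hh : HasFiberGenus f h) {b₀ : B} (hb₀ : b₀ ∈ criticalValues f) :
    (FiberComparison.componentClosures (f ⁻¹' {b₀} \ criticalPoints f)).Finite ∧
    {p | p ∈ separatingPoints OX OB f ∧ f p = b₀}.ncard + 1 ≤
      (FiberComparison.componentClosures (f ⁻¹' {b₀} \ criticalPoints f)).ncard ∧
    {p | p ∈ criticalPoints f ∧ f p = b₀}.ncard + 1 ≤
      h + (FiberComparison.componentClosures (f ⁻¹' {b₀} \ criticalPoints f)).ncard := by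
  classical
  let κ := {p // p ∈ criticalPoints f ∧ f p = b₀}
  have hfin := hf.finite_criticalPoints
  have : Finite κ := (hfin.subset fun p hp => hp.1 : {p | p ∈ criticalPoints f ∧ f p = b₀}.Finite)
  have := Fintype.ofFinite κ
  -- The vanishing cycle depends on the chart, so at a separating point the chart must be one that
  -- witnesses the separation.
  have hchart : ∀ p : κ, ∃ φ ψ, IsLefschetzChart OX OB f p.1 φ ψ ∧
      (p.1 ∈ separatingPoints OX OB f →
        ∀ᶠ b in 𝓝[≠] b₀, ¬ IsPreconnected (f ⁻¹' {b} \ vanishingCycle f φ b)) := by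
    intro p
    by_cases hp : p.1 ∈ separatingPoints OX OB f
    · obtain ⟨-, φ, ψ, hL, hev⟩ := hp
      rw [p.2.2] at hev
      exact ⟨φ, ψ, hL, fun _ => hev⟩
    · obtain ⟨φ, ψ, hL⟩ := hf.local_form p.1 p.2.1
      exact ⟨φ, ψ, hL, fun h => absurd h hp⟩
  choose φ ψ hL hsep using hchart
  obtain ⟨ι, _, _, V, A, pos, neg, hev⟩ := exists_fiberComparison hf hb₀ φ ψ hL
  have hev' : ∀ᶠ b in 𝓝[≠] b₀, b ∉ criticalValues f := by
    have hc : ((criticalValues f) \ {b₀}).Finite := (hfin.image f).sdiff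
    filter_upwards [self_mem_nhdsWithin,
      nhdsWithin_le_nhds (hc.isClosed.isOpen_compl.mem_nhds (x := b₀) (by simp))] with b hb hb' hbc
    exact hb' ⟨hbc, hb⟩
  have hev'' : ∀ᶠ b in 𝓝[≠] b₀, ∀ p : κ, p.1 ∈ separatingPoints OX OB f →
      ¬ IsPreconnected (f ⁻¹' {b} \ vanishingCycle f (φ p) b) :=
    Filter.eventually_all.2 fun p => Filter.eventually_imp_distrib_left.2 (hsep p)
  have := neBot_nhdsNE_of_chartedSpace b₀
  -- A single regular value `b` near `b₀` serves all the conditions, because `b₀` is not isolated in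
  -- `B`.
  obtain ⟨b, ⟨H, hhomeo, hdisj⟩, hreg, hsepb⟩ := (hev.and (hev'.and hev'')).exists
  have hS := isPreconnected_fiber_of_hasGenus hf.smooth hreg (hh b hreg)
  have hne : ∀ K : Set κ, (f ⁻¹' {b} \ ⋃ q ∈ K, vanishingCycle f (φ q) b).Nonempty := fun K =>
    (H.piece_inter_nonempty (Classical.arbitrary ι)).mono (H.piece_subset _ K)
  refine ⟨H.finite_componentClosures, ?_, ?_⟩
  · let I : Finset κ := Finset.univ.filter fun p => p.1 ∈ separatingPoints OX OB f
    have hI : {p | p ∈ separatingPoints OX OB f ∧ f p = b₀}.ncard = I.card := by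
      have : {p | p ∈ separatingPoints OX OB f ∧ f p = b₀} = Subtype.val '' (I : Set κ) := by
        ext p
        constructor
        · rintro ⟨hp, hpb⟩
          exact ⟨⟨p, hp.1, hpb⟩, Finset.mem_coe.2 (Finset.mem_filter.2 ⟨Finset.mem_univ _, hp⟩), rfl⟩
        · rintro ⟨q, hq, rfl⟩
          exact ⟨(Finset.mem_filter.1 (Finset.mem_coe.1 hq)).2, q.2.2⟩
      rw [this, ncard_image_of_injective _ Subtype.val_injective, ncard_coe_finset]
    rw [hI]
    refine H.card_lt_ncard ∅ I (by simp) (by simpa using hS) fun p hp => ?_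
    have := hsepb p (Finset.mem_filter.1 hp).2
    simpa using this
  -- By maximality of `K`, every cycle outside it disconnects what remains, so `I` can be the whole
  -- complement; the genus bounds `K`.
  · obtain ⟨K, hK, hmax⟩ := (toFinite {K : Finset κ |
      IsConnected (f ⁻¹' {b} \ ⋃ q ∈ (K : Set κ), vanishingCycle f (φ q) b)}).exists_maximal
      ⟨∅, hne _, by simpa using hS⟩
    have hKh := (hh b hreg).card_le K H.circle_subset hhomeo hdisj hK
    have hI := H.card_lt_ncard K Kᶜ (by simp) hK.isPreconnected fun p hp hpre => by
      have hpK : p ∉ K := by simpa using hp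
      refine hpK (hmax (y := insert p K) ⟨hne _, ?_⟩ (Finset.subset_insert _ _)
        (Finset.mem_insert_self _ _))
      rwa [Finset.coe_insert]
    have hcard : {p | p ∈ criticalPoints f ∧ f p = b₀}.ncard = Fintype.card κ := by
      rw [← Nat.card_coe_set_eq, ← Nat.card_eq_fintype_card]
      rfl
    have := Finset.card_compl_add_card K
    omega

end

/-! ### Summation over the singular fibers -/

theorem Set.Finite.ncard_eq_sum_fiberwise {α β : Type*} {s : Set α} (hs : s.Finite) (g : α → β)
    (t : Finset β) (hst : ∀ x ∈ s, g x ∈ t) :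
    s.ncard = ∑ b ∈ t, {x | x ∈ s ∧ g x = b}.ncard := by
  classical
  rw [ncard_eq_toFinset_card s hs, Finset.card_eq_sum_card_fiberwise (f := g) (t := t)
    (by simpa [MapsTo] using hst)]
  refine Finset.sum_congr rfl fun b _ => ?_
  rw [← ncard_coe_finset]
  congr 1
  ext x
  simp

theorem proposition6 {X B : Type*}
    [TopologicalSpace X] [T2Space X] [CompactSpace X] [ConnectedSpace X]
    [ChartedSpace (EuclideanSpace ℝ (Fin 4)) X] [IsManifold (𝓡 4) ∞ X]
    [TopologicalSpace B] [T2Space B] [CompactSpace B] [ConnectedSpace B]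
    [ChartedSpace (EuclideanSpace ℝ (Fin 2)) B] [IsManifold (𝓡 2) ∞ B]
    (OX : SmoothOrientation 4 X) (OB : SmoothOrientation 2 B)
    (f : X → B) (hf : IsLefschetzFibration OX OB f)
    (h : ℕ) (hh : HasFiberGenus f h) :
    (criticalPoints f).Finite ∧ (singularFiberComponents f).Finite ∧
    (separatingPoints OX OB f).ncard + (criticalValues f).ncard
      ≤ (singularFiberComponents f).ncard ∧
    ((criticalPoints f).ncard : ℤ) - ((h : ℤ) - 1) * ((criticalValues f).ncard : ℤ)
      ≤ ((singularFiberComponents f).ncard : ℤ) := by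
  classical
  have hfin := hf.finite_criticalPoints
  have hD : (criticalValues f).Finite := hfin.image f
  let comps : B → Set (Set X) := fun b =>
    FiberComparison.componentClosures (f ⁻¹' {b} \ criticalPoints f)
  have hbd : ∀ b ∈ criticalValues f, _ := fun b hb => componentClosures_bounds hf hh hb
  have hunion : singularFiberComponents f = ⋃ b ∈ criticalValues f, comps b := by
    ext C
    simp only [singularFiberComponents, comps, FiberComparison.componentClosures, mem_iUnion,
      mem_ofPred_eq, exists_prop]
  -- Fibers are closed, so the closure of a component stays in its own fiber and no component is
  -- counted twice.
  have hpd : (criticalValues f).PairwiseDisjoint comps := by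
    intro b _ b' _ hne
    refine Set.disjoint_left.2 ?_
    rintro _ ⟨x, hx, rfl⟩ ⟨y, hy, hC⟩
    have hxC : x ∈ closure (connectedComponentIn (f ⁻¹' {b'} \ criticalPoints f) y) :=
      hC ▸ subset_closure (mem_connectedComponentIn hx)
    have hsub : closure (connectedComponentIn (f ⁻¹' {b'} \ criticalPoints f) y) ⊆ f ⁻¹' {b'} :=
      closure_minimal ((connectedComponentIn_subset _ _).trans sdiff_subset)
        (isClosed_singleton.preimage hf.smooth.continuous)
    exact hne (hx.1.symm.trans (hsub hxC))
  have hN : (singularFiberComponents f).ncard = ∑ b ∈ hD.toFinset, (comps b).ncard := by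
    rw [hunion, hD.ncard_biUnion (fun b hb => (hbd b hb).1) hpd,
      finsum_mem_eq_finite_toFinset_sum _ hD]
  have hs : (separatingPoints OX OB f).ncard = ∑ b ∈ hD.toFinset,
      {p | p ∈ separatingPoints OX OB f ∧ f p = b}.ncard :=
    (hfin.subset fun p hp => hp.1).ncard_eq_sum_fiberwise f _ fun p hp =>
      hD.mem_toFinset.2 ⟨p, hp.1, rfl⟩
  have hk : (criticalPoints f).ncard = ∑ b ∈ hD.toFinset,
      {p | p ∈ criticalPoints f ∧ f p = b}.ncard :=
    hfin.ncard_eq_sum_fiberwise f _ fun p hp => hD.mem_toFinset.2 ⟨p, hp, rfl⟩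
  have hDc : (criticalValues f).ncard = ∑ b ∈ hD.toFinset, 1 := by
    rw [ncard_eq_toFinset_card _ hD, Finset.card_eq_sum_ones]
  refine ⟨hfin, hunion ▸ hD.biUnion fun b hb => (hbd b hb).1, ?_, ?_⟩
  · rw [hs, hDc, hN, ← Finset.sum_add_distrib]
    exact Finset.sum_le_sum fun b hb => (hbd b (hD.mem_toFinset.1 hb)).2.1
  · have hle : (criticalPoints f).ncard + (criticalValues f).ncard ≤
        h * (criticalValues f).ncard + (singularFiberComponents f).ncard := by
      rw [hk, hDc, hN, Finset.mul_sum, ← Finset.sum_add_distrib, ← Finset.sum_add_distrib]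
      refine Finset.sum_le_sum fun b hb => ?_
      rw [mul_one]
      exact (hbd b (hD.mem_toFinset.1 hb)).2.2
    zify at hle
    linarith
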